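/- There exist universal constants $\alpha_1,\alpha_2,\alpha_3>0$ such that the following holds. Let $n$ and $k$ be non-negative integers with $k\le \alpha_1\sqrt n$. Let $\sigma_{n-1}$ be the rotation invariant probability measure on the unit sphere $S^{n-1}\subseteq\mathbb R^n$, and let $f:S^{n-1}\to[0,\infty)$ be a measurable function which depends only on the coordinates $x_1,\dots,x_k$ and satisfies $$\|f\|_{L^1(\sigma_{n-1})}=1,\qquad \|f\|_{L^\infty(\sigma_{n-1})}\le e^{\alpha_2\sqrt n}.$$ Let $H$ be a random linear subspace of $\mathbb R^n$ of dimension $\lfloor n/2\rfloor$, distributed according to the rotation invariant (Haar) probability measure $\mathbb P_H$ on the Grassmannian. For a subspace $F\subseteq\mathbb R^n$ let $\sigma_F$ denote the rotation invariant probability measure on the sphere $S_F=S^{n-1}\cap F$. Then $$\mathbb P_H\left(\sqrt{\int_{S_H}f\,d\sigma_H\cdot\int_{S_{H^\perp}}f\,d\sigma_{H^\perp}}\ \ge\ 0.9\right)\ \ge\ 1-\alpha_3e^{-\sqrt n}.$$ -/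

import Mathlib

open MeasureTheory Metric
open scoped ENNReal

noncomputable section

namespace SphereSampling

/-- The Euclidean space `ℝⁿ`. -/
abbrev E (n : ℕ) : Type := EuclideanSpace ℝ (Fin n)

/-! ### Uniform measures on spheres -/

/-- The rotation invariant probability measure on the unit sphere of a finite dimensional
Euclidean space `V` of positive dimension: the normalized surface measure. (If `V = {0}`, the
sphere is empty and this is the zero measure.) -/
def sphereMeasure (V : Type*) [NormedAddCommGroup V] [InnerProductSpace ℝ V]
    [FiniteDimensional ℝ V] [MeasurableSpace V] [BorelSpace V] :
    Measure (sphere (0 : V) 1) :=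
  ((volume : Measure V).toSphere Set.univ)⁻¹ • (volume : Measure V).toSphere

/-- The inclusion of the unit sphere `S_H` of a subspace `H` into the unit sphere of `ℝⁿ`. -/
def sphereInclusion {n : ℕ} (H : Submodule ℝ (E n)) (x : sphere (0 : H) 1) :
    sphere (0 : E n) 1 :=
  ⟨((x : H) : E n), mem_sphere_zero_iff_norm.mpr (mem_sphere_zero_iff_norm.mp x.2)⟩

/-- `σ_H`: the rotation invariant probability measure on `S_H = Sⁿ⁻¹ ∩ H`, regarded as a measure
on `Sⁿ⁻¹` concentrated on `Sⁿ⁻¹ ∩ H`. -/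
def subspaceSphereMeasure {n : ℕ} (H : Submodule ℝ (E n)) : Measure (sphere (0 : E n) 1) :=
  (sphereMeasure H).map (sphereInclusion H)

theorem isProbabilityMeasure_sphereMeasure (V : Type*) [NormedAddCommGroup V]
    [InnerProductSpace ℝ V] [FiniteDimensional ℝ V] [MeasurableSpace V] [BorelSpace V]
    [Nontrivial V] : IsProbabilityMeasure (sphereMeasure V) := by
  refine ⟨?_⟩
  have h0 : (volume : Measure V).toSphere Set.univ ≠ 0 := by
    rw [Ne, Measure.measure_univ_eq_zero]
    exact Measure.toSphere_ne_zero _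
  simp only [sphereMeasure, Measure.smul_apply, smul_eq_mul]
  exact ENNReal.inv_mul_cancel h0 (measure_ne_top _ _)

theorem measurable_sphereInclusion {n : ℕ} (H : Submodule ℝ (E n)) :
    Measurable (sphereInclusion H) :=
  (measurable_subtype_coe.comp measurable_subtype_coe).subtype_mk

theorem isProbabilityMeasure_subspaceSphereMeasure {n : ℕ} (H : Submodule ℝ (E n))
    [Nontrivial H] : IsProbabilityMeasure (subspaceSphereMeasure H) :=
  have := isProbabilityMeasure_sphereMeasure H
  Measure.isProbabilityMeasure_map (measurable_sphereInclusion H).aemeasurable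

/-! ### The orthogonal group and its Haar probability measure -/

/-- The orthogonal group `O(n)`, as the group of linear maps `U : ℝⁿ → ℝⁿ` with
`U* U = U U* = 1`, with the topology of the operator norm. -/
abbrev OrthGroup (n : ℕ) : Type := unitary (E n →L[ℝ] E n)

instance continuousStar_endomorphisms (n : ℕ) : ContinuousStar (E n →L[ℝ] E n) :=
  ⟨(ContinuousLinearMap.adjoint (𝕜 := ℝ) (E := E n) (F := E n)).continuous⟩

instance compactSpace_orthGroup (n : ℕ) : CompactSpace (OrthGroup n) := by
  have : ProperSpace (E n →L[ℝ] E n) := FiniteDimensional.proper ℝ _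
  refine isCompact_iff_compactSpace.mp (Metric.isCompact_of_isClosed_isBounded ?_ ?_)
  · have h : ((unitary (E n →L[ℝ] E n) : Submonoid _) : Set (E n →L[ℝ] E n)) =
        {U | star U * U = 1} ∩ {U | U * star U = 1} := by
      ext U
      exact Unitary.mem_iff
    rw [h]
    exact (isClosed_eq (by fun_prop) continuous_const).inter
      (isClosed_eq (by fun_prop) continuous_const)
  · refine (Metric.isBounded_closedBall (x := (0 : E n →L[ℝ] E n)) (r := 1)).subset ?_
    intro U hU
    rw [mem_closedBall_zero_iff]
    refine ContinuousLinearMap.opNorm_le_bound _ zero_le_one fun x => ?_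
    have := (Unitary.linearIsometryEquiv (⟨U, hU⟩ : OrthGroup n)).norm_map x
    rw [one_mul]
    exact this.le

/-- The Haar probability measure on `O(n)`. -/
def haarOrth (n : ℕ) : Measure (OrthGroup n) :=
  Measure.haarMeasure ⊤

theorem isProbabilityMeasure_haarOrth (n : ℕ) : IsProbabilityMeasure (haarOrth n) :=
  ⟨by simpa [haarOrth] using
    Measure.haarMeasure_self (K₀ := (⊤ : TopologicalSpace.PositiveCompacts (OrthGroup n)))⟩

/-! ### The Grassmannian and its Haar probability measure -/

/-- The Grassmannian of `m`-dimensional linear subspaces of `ℝⁿ`. -/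
def Gr (n m : ℕ) : Type := {H : Submodule ℝ (E n) // Module.finrank ℝ H = m}

/-- The usual topology of the Grassmannian: the distance of two subspaces is the operator norm of
the difference of their orthogonal projections. -/
instance topologicalSpaceGr (n m : ℕ) : TopologicalSpace (Gr n m) :=
  TopologicalSpace.induced (fun H => H.1.starProjection) inferInstance

instance measurableSpaceGr (n m : ℕ) : MeasurableSpace (Gr n m) := borel _

instance borelSpaceGr (n m : ℕ) : BorelSpace (Gr n m) := ⟨rfl⟩

/-- The image `U H` of a subspace `H` under an orthogonal transformation `U`. -/
def rotate {n m : ℕ} (U : OrthGroup n) (H : Gr n m) : Gr n m :=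
  ⟨H.1.map ((Unitary.linearIsometryEquiv U).toLinearEquiv : E n →ₗ[ℝ] E n), by
    rw [LinearEquiv.finrank_map_eq]
    exact H.2⟩

/-- The coordinate subspace of `ℝⁿ` spanned by the first `m` vectors of the standard basis. -/
def coordSubspace (n m : ℕ) (hm : m ≤ n) : Gr n m :=
  ⟨Submodule.span ℝ
      (Set.range fun i : Fin m => (EuclideanSpace.single (Fin.castLE hm i) (1 : ℝ) : E n)), by
    have h : LinearIndependent ℝ
        (fun i : Fin m => (EuclideanSpace.single (Fin.castLE hm i) (1 : ℝ) : E n)) := by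
      have h' : (fun i : Fin m => (EuclideanSpace.single (Fin.castLE hm i) (1 : ℝ) : E n)) =
          (EuclideanSpace.basisFun (Fin n) ℝ).toBasis ∘ Fin.castLE hm := by
        funext i
        simp
      rw [h']
      exact (EuclideanSpace.basisFun (Fin n) ℝ).toBasis.linearIndependent.comp
        (Fin.castLE hm) (Fin.castLE_injective hm)
    rw [finrank_span_eq_card h, Fintype.card_fin]⟩

/-- The rotation invariant (Haar) probability measure on the Grassmannian of `m`-dimensional
subspaces of `ℝⁿ`: the law of `U H₀`, where `U` is a Haar distributed random orthogonal
transformation and `H₀` is the coordinate subspace of dimension `m`. -/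
def haarGr (n m : ℕ) (hm : m ≤ n) : Measure (Gr n m) :=
  (haarOrth n).map fun U => rotate U (coordSubspace n m hm)

theorem continuous_rotate_left {n m : ℕ} (H : Gr n m) :
    Continuous fun U : OrthGroup n => rotate U H := by
  rw [continuous_induced_rng]
  have h : ((fun H : Gr n m => H.1.starProjection) ∘ fun U : OrthGroup n => rotate U H) =
      fun U : OrthGroup n => (U : E n →L[ℝ] E n) * H.1.starProjection *
        star (U : E n →L[ℝ] E n) := by
    funext U
    ext1 x
    exact Submodule.starProjection_map_apply (Unitary.linearIsometryEquiv U) H.1 x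
  rw [h]
  fun_prop

theorem isProbabilityMeasure_haarGr (n m : ℕ) (hm : m ≤ n) :
    IsProbabilityMeasure (haarGr n m hm) :=
  have := isProbabilityMeasure_haarOrth n
  Measure.isProbabilityMeasure_map (continuous_rotate_left _).measurable.aemeasurable

/-- The measure `haarGr` is invariant under every orthogonal transformation. -/
theorem map_rotate_haarGr (n m : ℕ) (hm : m ≤ n) (U : OrthGroup n) :
    (haarGr n m hm).map (rotate U) = haarGr n m hm := by
  have hcomp : ∀ V : OrthGroup n, ∀ H : Gr n m, rotate U (rotate V H) = rotate (U * V) H := by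
    intro V H
    apply Subtype.ext
    ext x
    simp [rotate]
    exact Iff.rfl
  have hU : Continuous (rotate U : Gr n m → Gr n m) := by
    rw [continuous_induced_rng]
    have h : ((fun H : Gr n m => H.1.starProjection) ∘ (rotate U : Gr n m → Gr n m)) =
        fun H : Gr n m => (U : E n →L[ℝ] E n) * H.1.starProjection *
          star (U : E n →L[ℝ] E n) := by
      funext H
      ext1 x
      exact Submodule.starProjection_map_apply (Unitary.linearIsometryEquiv U) H.1 x
    rw [h]
    have hp : Continuous fun H : Gr n m => H.1.starProjection := continuous_induced_dom
    fun_prop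
  have hleft : (haarOrth n).map (fun V => U * V) = haarOrth n := by
    unfold haarOrth
    exact map_mul_left_eq_self _ U
  have hr := (continuous_rotate_left (coordSubspace n m hm)).measurable
  conv_rhs => rw [haarGr, ← hleft]
  rw [haarGr, Measure.map_map hU.measurable hr,
    Measure.map_map hr (measurable_const_mul U)]
  congr 1
  funext V
  exact hcomp V _

/-! ### Functions of the first coordinates -/

/-- A function on `Sⁿ⁻¹` depends only on the coordinates `x₁, …, x_k`. -/
def DependsOnFirst {n : ℕ} (k : ℕ) (f : sphere (0 : E n) 1 → ℝ) : Prop :=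
  ∀ x y : sphere (0 : E n) 1,
    (∀ i : Fin n, (i : ℕ) < k → (x : E n) i = (y : E n) i) → f x = f y

end SphereSampling

end

open SphereSampling

/-!
Write `Π_H` for the orthogonal projection to `H`, `J : ℝᵏ → ℝⁿ` for the inclusion as the first
coordinates, `T = J* Π_H J` and `D = 2 T - 1` (`deviation`). For the orthogonal complement of `H`
the operators are `1 - T` and `-D`. Since `f` is a function `h` of the first `k` coordinates, the
three integrals of the statement are integrals of `h` against densities on `ℝᵏ`.

The first `k` coordinates of a uniform point of `Sⁿ⁻¹` have the density
`c (1 - ‖z‖²)₊ ^ ((n - k - 2) / 2)` (`lintegral_sphereMeasure_coisometry`). If `H` has dimension `m`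
and `T = M M*`, then the first `k` coordinates of a uniform point of `S_H` have the density
`c' |det M|⁻¹ (1 - ⟨T⁻¹ z, z⟩)₊ ^ ((m - k - 2) / 2)` (`exists_density_subspace`). In the geometric
mean of the densities for `H` and for its complement the terms of first order in `D` cancel:
`⟨T⁻¹ z, z⟩ + ⟨(1 - T)⁻¹ z, z⟩ = 4 ⟨(1 - D²)⁻¹ z, z⟩` and `det (T (1 - T)) ≤ 4⁻ᵏ`. So if `‖D‖²` is
at most a constant over `√n`, the geometric mean is at least a number close to `1` times the density
for `ℝⁿ`, as long as `‖z‖²` is at most a small constant over `√n`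
(`mul_sq_lintegral_le_mul_lintegral`). The remaining `z` carry little of the mass of `f`, by
Chernoff's bound and the bound on `f`, and the Cauchy–Schwarz inequality gives the conclusion for
each such `H` (`le_sqrt_integral_mul_integral`).

It remains to bound `‖D‖` for a random `H` (`haarOrth_deviation_le`). For a fixed unit vector
`θ` of `ℝᵏ` the number `⟨D θ, θ⟩ + 1` is twice the squared norm of the projection of a uniform
point of the sphere to a fixed subspace of dimension `⌊n / 2⌋`, which is concentrated by Chernoff's
bound for Gaussian vectors. The passage to the norm costs a factor `9ᵏ`: a symmetric operator with
large norm has a large quadratic form on a whole ball of radius `1 / 8` (`measure_lt_norm_le`).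
-/

open scoped InnerProductSpace

/-! ### Polar coordinates and Gaussian integrals -/

theorem lintegral_polar {V : Type*} [NormedAddCommGroup V] [InnerProductSpace ℝ V]
    [FiniteDimensional ℝ V] [MeasurableSpace V] [BorelSpace V] [Nontrivial V]
    {g : V → ℝ≥0∞} (hg : Measurable g) {φ : ℝ → ℝ≥0∞} (hφ : Measurable φ) :
    ∫⁻ x : V, g (‖x‖⁻¹ • x) * φ ‖x‖ =
      (∫⁻ θ, g (θ : V) ∂(volume : Measure V).toSphere) *
        ∫⁻ r in Set.Ioi (0 : ℝ), ENNReal.ofReal (r ^ (Module.finrank ℝ V - 1)) * φ r := by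
  have hmp := (volume : Measure V).measurePreserving_homeomorphUnitSphereProd
  conv_lhs => rw [← restrict_compl_singleton (μ := (volume : Measure V)) 0]
  rw [← lintegral_subtype_comap (measurableSet_singleton _).compl
      (fun x : V => g (‖x‖⁻¹ • x) * φ ‖x‖)]
  have h1 := hmp.lintegral_comp (f := fun p => g (p.1 : V) * φ (p.2 : ℝ)) (by fun_prop)
  simp only [homeomorphUnitSphereProd_apply_fst_coe, homeomorphUnitSphereProd_apply_snd_coe] at h1
  rw [h1, lintegral_prod_mul (f := fun θ : sphere (0 : V) 1 => g θ)
    (g := fun r : Set.Ioi (0 : ℝ) => φ r)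
    (by fun_prop) (by fun_prop)]
  congr 1
  rw [Measure.volumeIoiPow, lintegral_withDensity_eq_lintegral_mul _ (by fun_prop) (by fun_prop)]
  exact lintegral_subtype_comap measurableSet_Ioi
    (fun r : ℝ => ENNReal.ofReal (r ^ (Module.finrank ℝ V - 1)) * φ r)

/-- The area of the unit sphere of an `N`-dimensional Euclidean space. -/
theorem toSphere_univ_eq_gamma {V : Type*} [NormedAddCommGroup V] [InnerProductSpace ℝ V]
    [FiniteDimensional ℝ V] [MeasurableSpace V] [BorelSpace V] [Nontrivial V] :
    (volume : Measure V).toSphere Set.univ =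
      ENNReal.ofReal (2 * Real.pi ^ ((Module.finrank ℝ V : ℝ) / 2) /
        Real.Gamma ((Module.finrank ℝ V : ℝ) / 2)) := by
  have hN : 0 < (Module.finrank ℝ V : ℝ) := by exact_mod_cast Module.finrank_pos
  have hG : 0 < Real.Gamma ((Module.finrank ℝ V : ℝ) / 2) := Real.Gamma_pos_of_pos (by positivity)
  rw [Measure.toSphere_apply_univ, InnerProductSpace.volume_ball, ENNReal.ofReal_one, one_pow,
    one_mul, Real.Gamma_add_one (by positivity), ← ENNReal.ofReal_natCast,
    ← ENNReal.ofReal_mul (by positivity)]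
  congr 1
  rw [Real.sqrt_eq_rpow, ← Real.rpow_natCast, ← Real.rpow_mul Real.pi_pos.le]
  field_simp

theorem lintegral_exp_neg_mul_sq_norm (V : Type*) [NormedAddCommGroup V] [InnerProductSpace ℝ V]
    [FiniteDimensional ℝ V] [MeasurableSpace V] [BorelSpace V] {b : ℝ} (hb : 0 < b) :
    ∫⁻ x : V, ENNReal.ofReal (Real.exp (-b * ‖x‖ ^ 2)) =
      ENNReal.ofReal ((Real.pi / b) ^ ((Module.finrank ℝ V : ℝ) / 2)) := by
  have h := GaussianFourier.integral_rexp_neg_mul_sq_norm (V := V) hb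
  rw [← h, ofReal_integral_eq_lintegral_ofReal]
  · by_contra hn
    rw [integral_undef hn] at h
    have : 0 < (Real.pi / b) ^ ((Module.finrank ℝ V : ℝ) / 2) :=
      Real.rpow_pos_of_pos (by positivity) _
    linarith
  · exact Filter.Eventually.of_forall fun x => (Real.exp_pos _).le

/-- A coisometry `W` onto `E k` is the first projection of an orthogonal splitting `E k × E d`
of its domain. -/
theorem exists_split_of_coisometry {V : Type*} [NormedAddCommGroup V] [InnerProductSpace ℝ V]
    [FiniteDimensional ℝ V] {k d : ℕ} (hV : Module.finrank ℝ V = k + d) (W : V →L[ℝ] E k)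
    (hW : ∀ z, W (W.adjoint z) = z) :
    ∃ Ψ : V ≃ₗᵢ[ℝ] WithLp 2 (E k × E d), ∀ x, (Ψ x).fst = W x := by
  have hsurj : Function.Surjective W.toLinearMap := fun z => ⟨_, hW z⟩
  have hker : Module.finrank ℝ (LinearMap.ker W.toLinearMap) = d := by
    have := W.toLinearMap.finrank_range_add_finrank_ker
    rw [LinearMap.range_eq_top.mpr hsurj, finrank_top, finrank_euclideanSpace_fin, hV] at this
    omega
  let Φ : LinearMap.ker W.toLinearMap ≃ₗᵢ[ℝ] E d :=
    ((stdOrthonormalBasis ℝ _).reindex (finCongr hker)).repr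
  let Q : V →ₗ[ℝ] LinearMap.ker W.toLinearMap :=
    LinearMap.codRestrict _ (LinearMap.id - W.adjoint.toLinearMap ∘ₗ W.toLinearMap)
      (fun x => by simp [hW])
  let f : V →ₗ[ℝ] WithLp 2 (E k × E d) :=
    (WithLp.linearEquiv 2 ℝ (E k × E d)).symm.toLinearMap ∘ₗ
      (W.toLinearMap.prod (Φ.toLinearEquiv.toLinearMap ∘ₗ Q))
  have hnorm : ∀ x, ‖f x‖ = ‖x‖ := by
    intro x
    rw [← sq_eq_sq₀ (norm_nonneg _) (norm_nonneg _), WithLp.prod_norm_sq_eq_of_L2]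
    have e1 : ‖(f x).fst‖ = ‖W x‖ := rfl
    have e2 : ‖(f x).snd‖ = ‖x - W.adjoint (W x)‖ := Φ.norm_map _
    rw [e1, e2, @norm_sub_sq_real, ContinuousLinearMap.adjoint_inner_right,
      real_inner_self_eq_norm_sq]
    have e3 : ‖W.adjoint (W x)‖ ^ 2 = ‖W x‖ ^ 2 := by
      rw [← real_inner_self_eq_norm_sq, ContinuousLinearMap.adjoint_inner_right, hW,
        real_inner_self_eq_norm_sq]
    rw [e3]; ring
  let fi : V →ₗᵢ[ℝ] WithLp 2 (E k × E d) := ⟨f, hnorm⟩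
  have hfr : Module.finrank ℝ V = Module.finrank ℝ (WithLp 2 (E k × E d)) := by
    rw [(WithLp.linearEquiv 2 ℝ (E k × E d)).finrank_eq, Module.finrank_prod,
      finrank_euclideanSpace_fin, finrank_euclideanSpace_fin, hV]
  exact ⟨fi.toLinearIsometryEquiv hfr, fun x => rfl⟩

/-- Integration in the coordinates given by a coisometry. -/
theorem lintegral_split_of_coisometry {V : Type*} [NormedAddCommGroup V] [InnerProductSpace ℝ V]
    [FiniteDimensional ℝ V] [MeasurableSpace V] [BorelSpace V]
    {k d : ℕ} (hV : Module.finrank ℝ V = k + d) (W : V →L[ℝ] E k)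
    (hW : ∀ z, W (W.adjoint z) = z) {F : E k → ℝ → ℝ≥0∞}
    (hF : Measurable (Function.uncurry F)) :
    ∫⁻ x : V, F (W x) ‖x‖ =
      ∫⁻ y : E k, ∫⁻ w : E d, F y (√(‖y‖ ^ 2 + ‖w‖ ^ 2)) := by
  obtain ⟨Ψ, hΨ⟩ := exists_split_of_coisometry hV W hW
  have hm := (WithLp.volume_preserving_ofLp (E k) (E d)).comp Ψ.measurePreserving
  have hF' : Measurable fun p : E k × E d => F p.1 (√(‖p.1‖ ^ 2 + ‖p.2‖ ^ 2)) :=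
    hF.comp (measurable_fst.prodMk (by fun_prop))
  rw [← lintegral_prod (fun p : E k × E d => F p.1 (√(‖p.1‖ ^ 2 + ‖p.2‖ ^ 2))) hF'.aemeasurable,
    ← Measure.volume_eq_prod, ← hm.lintegral_comp hF']
  refine lintegral_congr fun x => ?_
  have h1 : (WithLp.ofLp (Ψ x)).1 = W x := hΨ x
  have h2 : ‖(WithLp.ofLp (Ψ x)).1‖ ^ 2 + ‖(WithLp.ofLp (Ψ x)).2‖ ^ 2 = ‖x‖ ^ 2 := by
    rw [← Ψ.norm_map x, WithLp.prod_norm_sq_eq_of_L2]; rfl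
  simp only [Function.comp_apply]
  rw [h2, h1, Real.sqrt_sq (norm_nonneg _)]

/-! ### The projection of the uniform measure of the sphere -/

/-- The uniform distribution on the sphere is the law of the direction of a Gaussian vector. -/
theorem lintegral_sphereMeasure_eq_gaussian {V : Type*} [NormedAddCommGroup V]
    [InnerProductSpace ℝ V] [FiniteDimensional ℝ V] [MeasurableSpace V] [BorelSpace V]
    [Nontrivial V] {g : V → ℝ≥0∞} (hg : Measurable g) :
    ∫⁻ θ, g (θ : V) ∂sphereMeasure V =
      ∫⁻ x : V, g (‖x‖⁻¹ • x) * ENNReal.ofReal (Real.exp (-Real.pi * ‖x‖ ^ 2)) := by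
  have hφ : Measurable fun r : ℝ => ENNReal.ofReal (Real.exp (-Real.pi * r ^ 2)) := by fun_prop
  have h1 := lintegral_polar (V := V) (g := fun _ => 1) measurable_const hφ
  simp only [one_mul, lintegral_const] at h1
  rw [lintegral_exp_neg_mul_sq_norm V Real.pi_pos, div_self Real.pi_ne_zero, Real.one_rpow,
    ENNReal.ofReal_one] at h1
  rw [lintegral_polar hg hφ, sphereMeasure, lintegral_smul_measure, smul_eq_mul, mul_comm]
  congr 1
  exact (ENNReal.eq_inv_of_mul_eq_one_left ((mul_comm _ _).trans h1.symm)).symm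

/-- The radial constant of the Gaussian weight is the inverse of the area of the sphere. -/
theorem lintegral_pow_mul_gaussian (V : Type*) [NormedAddCommGroup V]
    [InnerProductSpace ℝ V] [FiniteDimensional ℝ V] [MeasurableSpace V] [BorelSpace V]
    [Nontrivial V] :
    ∫⁻ r in Set.Ioi (0 : ℝ), ENNReal.ofReal (r ^ (Module.finrank ℝ V - 1)) *
      ENNReal.ofReal (Real.exp (-Real.pi * r ^ 2)) =
      ((volume : Measure V).toSphere Set.univ)⁻¹ := by
  have hφ : Measurable fun r : ℝ => ENNReal.ofReal (Real.exp (-Real.pi * r ^ 2)) := by fun_prop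
  have h1 := lintegral_polar (V := V) (g := fun _ => 1) measurable_const hφ
  simp only [one_mul, lintegral_const] at h1
  rw [lintegral_exp_neg_mul_sq_norm V Real.pi_pos, div_self Real.pi_ne_zero, Real.one_rpow,
    ENNReal.ofReal_one] at h1
  exact ENNReal.eq_inv_of_mul_eq_one_left ((mul_comm _ _).trans h1.symm)

/-- Substitution `R = √(a² + s²)` in a half-line integral. -/
theorem lintegral_sqrt_sq_add_sq {d : ℕ} (hd : 3 ≤ d) {a : ℝ} (ha : 0 ≤ a) (G : ℝ → ℝ≥0∞) :
    ∫⁻ s in Set.Ioi (0 : ℝ), ENNReal.ofReal (s ^ (d - 1)) * G (√(a ^ 2 + s ^ 2)) =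
      ∫⁻ R in Set.Ioi (0 : ℝ), ENNReal.ofReal R *
        ENNReal.ofReal (R ^ 2 - a ^ 2) ^ (((d : ℝ) - 2) / 2) * G R := by
  have hp : 0 < ((d : ℝ) - 2) / 2 := by
    have : (3 : ℝ) ≤ d := by exact_mod_cast hd
    linarith
  have himg : (fun s : ℝ => √(a ^ 2 + s ^ 2)) '' Set.Ioi 0 = Set.Ioi a := by
    ext R
    simp only [Set.mem_image, Set.mem_Ioi]
    constructor
    · rintro ⟨s, hs, rfl⟩
      exact Real.lt_sqrt_of_sq_lt (by nlinarith)
    · intro hR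
      refine ⟨√(R ^ 2 - a ^ 2), Real.sqrt_pos.mpr (by nlinarith), ?_⟩
      rw [Real.sq_sqrt (by nlinarith), add_sub_cancel, Real.sqrt_sq (by linarith)]
  have hcv := lintegral_image_eq_lintegral_abs_deriv_mul (s := Set.Ioi (0 : ℝ))
    (f := fun s : ℝ => √(a ^ 2 + s ^ 2)) (f' := fun s => s / √(a ^ 2 + s ^ 2)) measurableSet_Ioi
    (fun s hs => by
      have hs : 0 < s := hs
      have h : HasDerivAt (fun s : ℝ => a ^ 2 + s ^ 2) (2 * s) s := by
        simpa using (hasDerivAt_pow 2 s).const_add (a ^ 2)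
      refine (h.sqrt (by positivity)).hasDerivWithinAt.congr_deriv ?_
      field_simp)
    (fun s hs t ht hst => by
      have hs : 0 < s := hs
      have ht : 0 < t := ht
      have := (Real.sqrt_inj (by positivity) (by positivity)).mp hst
      exact (pow_left_inj₀ hs.le ht.le two_ne_zero).mp (by linarith))
    (fun R => ENNReal.ofReal R *
        ENNReal.ofReal (R ^ 2 - a ^ 2) ^ (((d : ℝ) - 2) / 2) * G R)
  rw [himg] at hcv
  have hsub : Set.Ioi a ⊆ Set.Ioi 0 := Set.Ioi_subset_Ioi ha
  have hzero : ∫⁻ R in Set.Ioi (0 : ℝ), ENNReal.ofReal R *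
        ENNReal.ofReal (R ^ 2 - a ^ 2) ^ (((d : ℝ) - 2) / 2) * G R =
      ∫⁻ R in Set.Ioi a, ENNReal.ofReal R *
        ENNReal.ofReal (R ^ 2 - a ^ 2) ^ (((d : ℝ) - 2) / 2) * G R := by
    rw [← lintegral_indicator measurableSet_Ioi, ← lintegral_indicator measurableSet_Ioi]
    refine lintegral_congr fun R => ?_
    by_cases hR : a < R
    · rw [Set.indicator_of_mem (show R ∈ Set.Ioi a from hR), Set.indicator_of_mem (hsub hR)]
    · rw [Set.indicator_of_notMem (show R ∉ Set.Ioi a from hR)]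
      by_cases hR0 : 0 < R
      · rw [Set.indicator_of_mem (show R ∈ Set.Ioi (0 : ℝ) from hR0),
          ENNReal.ofReal_of_nonpos (p := R ^ 2 - a ^ 2) (by nlinarith), ENNReal.zero_rpow_of_pos hp]
        simp
      · rw [Set.indicator_of_notMem (show R ∉ Set.Ioi (0 : ℝ) from hR0)]
  rw [hzero, hcv]
  refine setLIntegral_congr_fun measurableSet_Ioi fun s hs => ?_
  have hs : 0 < s := hs
  have hR : 0 < √(a ^ 2 + s ^ 2) := Real.sqrt_pos.mpr (by positivity)
  rw [← mul_assoc]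
  congr 1
  rw [Real.sq_sqrt (by positivity), add_sub_cancel_left, abs_of_nonneg (by positivity),
    ENNReal.ofReal_rpow_of_nonneg (by positivity) hp.le, ← ENNReal.ofReal_mul hR.le,
    ← ENNReal.ofReal_mul (by positivity)]
  congr 1
  rw [← Real.rpow_natCast s 2, ← Real.rpow_mul hs.le]
  have : ((2 : ℕ) : ℝ) * (((d : ℝ) - 2) / 2) = ((d - 2 : ℕ) : ℝ) := by
    rw [Nat.cast_sub (by omega)]; push_cast; ring
  rw [this, show d - 1 = (d - 2) + 1 by omega, pow_succ]
  field_simp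
  rw [Real.rpow_natCast]

theorem lintegral_comp_inv_smul {k : ℕ} {R : ℝ} (hR : 0 < R) {G : E k → ℝ≥0∞}
    (hG : Measurable G) :
    ∫⁻ y : E k, G (R⁻¹ • y) = ENNReal.ofReal (R ^ k) * ∫⁻ z, G z := by
  have h := Measure.map_addHaar_smul (volume : Measure (E k)) (inv_ne_zero hR.ne')
  rw [← lintegral_map hG (measurable_const_smul R⁻¹), h, lintegral_smul_measure,
    finrank_euclideanSpace_fin, smul_eq_mul, inv_pow, inv_inv, abs_of_nonneg (by positivity)]

/-- The density, up to the constant `projConst k d`, of the projection to `ℝᵏ` of the uniform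
measure on the unit sphere of `ℝᵏ⁺ᵈ`. It vanishes outside of the unit ball if `2 < d`. -/
noncomputable def projWeight {k : ℕ} (d : ℕ) (z : E k) : ℝ≥0∞ :=
  ENNReal.ofReal (1 - ‖z‖ ^ 2) ^ (((d : ℝ) - 2) / 2)

/-- The normalizing constant belonging to `projWeight`. -/
noncomputable def projConst (k d : ℕ) : ℝ :=
  Real.Gamma (((k + d : ℕ) : ℝ) / 2) / (Real.pi ^ ((k : ℝ) / 2) * Real.Gamma ((d : ℝ) / 2))

@[fun_prop]
theorem measurable_projWeight {k d : ℕ} : Measurable (projWeight d : E k → ℝ≥0∞) := by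
  unfold projWeight; fun_prop

theorem projConst_pos (k : ℕ) {d : ℕ} (hd : 0 < d) : 0 < projConst k d := by
  have : (0 : ℝ) < d := by exact_mod_cast hd
  have h1 : 0 < Real.Gamma (((k + d : ℕ) : ℝ) / 2) := Real.Gamma_pos_of_pos (by
    push_cast; positivity)
  have h2 : 0 < Real.Gamma ((d : ℝ) / 2) := Real.Gamma_pos_of_pos (by positivity)
  unfold projConst
  positivity

/-- The law of the projection of a uniform point of the sphere to a `k`-dimensional space.
A Gaussian vector is integrated in polar coordinates along the kernel of the projection. -/
theorem lintegral_sphereMeasure_coisometry {V : Type*} [NormedAddCommGroup V]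
    [InnerProductSpace ℝ V] [FiniteDimensional ℝ V] [MeasurableSpace V] [BorelSpace V]
    {k d : ℕ} (hd : 3 ≤ d) (hV : Module.finrank ℝ V = k + d) (W : V →L[ℝ] E k)
    (hW : ∀ z, W (W.adjoint z) = z) {g : E k → ℝ≥0∞} (hg : Measurable g) :
    ∫⁻ x, g (W (x : V)) ∂sphereMeasure V =
      ENNReal.ofReal (projConst k d) * ∫⁻ z, g z * projWeight d z := by
  have : Nontrivial V := Module.nontrivial_of_finrank_pos (R := ℝ) (by omega)
  have : Nontrivial (E d) := Module.nontrivial_of_finrank_pos (R := ℝ) (by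
    rw [finrank_euclideanSpace_fin]; omega)
  set p : ℝ := ((d : ℝ) - 2) / 2 with hp
  have hp0 : 0 < p := by
    have : (3 : ℝ) ≤ d := by exact_mod_cast hd
    rw [hp]; linarith
  set φ : ℝ → ℝ≥0∞ := fun r => ENNReal.ofReal (Real.exp (-Real.pi * r ^ 2)) with hφdef
  have hφ : Measurable φ := by fun_prop
  set F : E k → ℝ → ℝ≥0∞ := fun y R => g (R⁻¹ • y) * φ R with hFdef
  have hF : Measurable (Function.uncurry F) := by
    have : Measurable fun q : E k × ℝ => q.2⁻¹ • q.1 := by fun_prop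
    exact (hg.comp this).mul (hφ.comp measurable_snd)
  have h1 : ∫⁻ x, g (W (x : V)) ∂sphereMeasure V = ∫⁻ x : V, F (W x) ‖x‖ := by
    rw [lintegral_sphereMeasure_eq_gaussian (g := fun x => g (W x)) (by fun_prop)]
    simp only [hFdef, hφdef, map_smul]
  have h2 : ∀ y : E k, ∫⁻ w : E d, F y (√(‖y‖ ^ 2 + ‖w‖ ^ 2)) =
      (volume : Measure (E d)).toSphere Set.univ * ∫⁻ R in Set.Ioi (0 : ℝ), ENNReal.ofReal R *
        ENNReal.ofReal (R ^ 2 - ‖y‖ ^ 2) ^ p * F y R := by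
    intro y
    have hy : Measurable (F y) := hF.comp measurable_prodMk_left
    have := lintegral_polar (V := E d) (g := fun _ => 1) measurable_const
      (φ := fun s => F y (√(‖y‖ ^ 2 + s ^ 2))) (by fun_prop)
    simp only [one_mul, lintegral_const] at this
    rw [this, finrank_euclideanSpace_fin, lintegral_sqrt_sq_add_sq hd (norm_nonneg y)]
  have hI : Measurable (Function.uncurry fun (y : E k) (R : ℝ) => ENNReal.ofReal R *
      ENNReal.ofReal (R ^ 2 - ‖y‖ ^ 2) ^ p * F y R) := by
    refine Measurable.mul ?_ hF
    fun_prop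
  rw [h1, lintegral_split_of_coisometry hV W hW hF]
  simp_rw [h2]
  rw [lintegral_const_mul' _ _ (measure_ne_top _ _), lintegral_lintegral_swap hI.aemeasurable]
  -- The substitution `y = R z` separates the radial integral from the integral over `z`.
  have h3 : ∀ R ∈ Set.Ioi (0 : ℝ), ∫⁻ y : E k, ENNReal.ofReal R *
      ENNReal.ofReal (R ^ 2 - ‖y‖ ^ 2) ^ p * F y R =
      ENNReal.ofReal (R ^ (Module.finrank ℝ V - 1)) * φ R * ∫⁻ z, g z * projWeight d z := by
    intro R hR
    have hR : 0 < R := hR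
    have e : ∀ y : E k, ENNReal.ofReal R * ENNReal.ofReal (R ^ 2 - ‖y‖ ^ 2) ^ p * F y R =
        ENNReal.ofReal (R ^ (d - 1)) * φ R *
          (fun z => g z * projWeight d z) (R⁻¹ • y) := by
      intro y
      have e1 : ENNReal.ofReal (R ^ 2 - ‖y‖ ^ 2) ^ p =
          ENNReal.ofReal (R ^ (d - 2)) * projWeight d (R⁻¹ • y) := by
        have e2 : R ^ 2 - ‖y‖ ^ 2 = R ^ 2 * (1 - ‖R⁻¹ • y‖ ^ 2) := by
          rw [norm_smul, Real.norm_of_nonneg (by positivity)]; field_simp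
        rw [e2, ENNReal.ofReal_mul (by positivity), ENNReal.mul_rpow_of_nonneg _ _ hp0.le,
          ENNReal.ofReal_rpow_of_nonneg (by positivity) hp0.le, projWeight]
        congr 2
        rw [← Real.rpow_natCast R 2, ← Real.rpow_mul hR.le]
        have : ((2 : ℕ) : ℝ) * p = ((d - 2 : ℕ) : ℝ) := by
          rw [hp, Nat.cast_sub (by omega)]; push_cast; ring
        rw [this, Real.rpow_natCast]
      rw [e1, show d - 1 = (d - 2) + 1 by omega, pow_succ, ENNReal.ofReal_mul (by positivity)]
      simp only [hFdef]
      ring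
    simp_rw [e]
    rw [lintegral_const_mul _ (by fun_prop),
      lintegral_comp_inv_smul hR (G := fun z => g z * projWeight d z) (by fun_prop), hV,
      show k + d - 1 = (d - 1) + k by omega, pow_add, ENNReal.ofReal_mul (by positivity)]
    ring
  rw [setLIntegral_congr_fun measurableSet_Ioi h3, lintegral_mul_const _ (by fun_prop),
    lintegral_pow_mul_gaussian, ← mul_assoc]
  congr 1
  rw [toSphere_univ_eq_gamma, toSphere_univ_eq_gamma, hV, finrank_euclideanSpace_fin]
  have hd0 : (0 : ℝ) < d := by exact_mod_cast (by omega : 0 < d)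
  have hG1 : 0 < Real.Gamma ((d : ℝ) / 2) := Real.Gamma_pos_of_pos (by positivity)
  have hG2 : 0 < Real.Gamma (((k + d : ℕ) : ℝ) / 2) := Real.Gamma_pos_of_pos (by
    push_cast; positivity)
  rw [← ENNReal.ofReal_inv_of_pos (by positivity), ← ENNReal.ofReal_mul (by positivity),
    projConst]
  congr 1
  have : Real.pi ^ (((k + d : ℕ) : ℝ) / 2) = Real.pi ^ ((k : ℝ) / 2) * Real.pi ^ ((d : ℝ) / 2) := by
    rw [← Real.rpow_add Real.pi_pos]; push_cast; congr 1; ring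
  rw [this]
  have := Real.rpow_pos_of_pos Real.pi_pos ((d : ℝ) / 2)
  have := Real.rpow_pos_of_pos Real.pi_pos ((k : ℝ) / 2)
  field_simp

/-! ### The law of a linear image of a uniform point of the sphere -/

/-- Polar decomposition of a surjective linear map: a coisometry followed by an isomorphism. -/
theorem exists_equiv_comp_coisometry {V : Type*} [NormedAddCommGroup V] [InnerProductSpace ℝ V]
    [FiniteDimensional ℝ V] {k : ℕ} (L : V →L[ℝ] E k) (hL : Function.Surjective L) :
    ∃ (M : E k ≃L[ℝ] E k) (W : V →L[ℝ] E k), (∀ z, W (W.adjoint z) = z) ∧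
      (∀ x, L x = M (W x)) ∧
      ∀ z, M ((M : E k →L[ℝ] E k).adjoint z) = L (L.adjoint z) := by
  set K := LinearMap.ker L.toLinearMap with hK
  have hdim : Module.finrank ℝ Kᗮ = k := by
    have h1 : Module.finrank ℝ (LinearMap.range L.toLinearMap) + Module.finrank ℝ K =
      Module.finrank ℝ V := L.toLinearMap.finrank_range_add_finrank_ker
    have h2 := K.finrank_add_finrank_orthogonal
    rw [LinearMap.range_eq_top.mpr hL, finrank_top, finrank_euclideanSpace_fin] at h1
    omega
  let b : Kᗮ ≃ₗᵢ[ℝ] E k := ((stdOrthonormalBasis ℝ Kᗮ).reindex (finCongr hdim)).repr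
  let ι : E k →L[ℝ] V := Kᗮ.subtypeL ∘L (b.symm : E k →L[ℝ] Kᗮ)
  have hW : ∀ z, ι.adjoint (ι z) = z := by
    intro z
    refine ext_inner_right ℝ fun w => ?_
    rw [ContinuousLinearMap.adjoint_inner_left]
    exact b.symm.inner_map_map z w
  have hLW : ∀ x, L x = L (ι (ι.adjoint x)) := by
    intro x
    have hmem : x - ι (ι.adjoint x) ∈ K := by
      rw [← K.orthogonal_orthogonal, Submodule.mem_orthogonal]
      intro u hu
      have hu' : u = ι (b ⟨u, hu⟩) := by simp [ι]
      rw [hu', inner_sub_right, ← ContinuousLinearMap.adjoint_inner_right ι,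
        ← ContinuousLinearMap.adjoint_inner_right ι, hW, sub_self]
    have : L (x - ι (ι.adjoint x)) = 0 := hmem
    rwa [map_sub, sub_eq_zero] at this
  have hinj : Function.Injective (L ∘L ι) := by
    rw [injective_iff_map_eq_zero]
    intro z hz
    have h1 : ι z ∈ K := hz
    have h2 : ι z ∈ Kᗮ := (b.symm z).2
    have h3 : ι z = 0 := (Submodule.disjoint_def.mp K.orthogonal_disjoint) _ h1 h2
    rw [← hW z, h3, map_zero]
  let M : E k ≃L[ℝ] E k :=
    (LinearEquiv.ofInjectiveEndo (L ∘L ι).toLinearMap hinj).toContinuousLinearEquiv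
  have hM : (M : E k →L[ℝ] E k) = L ∘L ι := by ext1 x; rfl
  refine ⟨M, ι.adjoint, fun z => ?_, fun x => ?_, fun z => ?_⟩
  · rw [ContinuousLinearMap.adjoint_adjoint, hW]
  · rw [hLW x]; rfl
  · rw [hM, ContinuousLinearMap.adjoint_comp]
    exact (hLW _).symm

/-- The law of `L x`, for a surjective `L` and a uniform point `x` of the sphere. -/
theorem exists_density_of_surjective {V : Type*} [NormedAddCommGroup V]
    [InnerProductSpace ℝ V] [FiniteDimensional ℝ V] [MeasurableSpace V] [BorelSpace V]
    {k d : ℕ} (hd : 3 ≤ d) (hV : Module.finrank ℝ V = k + d) (L : V →L[ℝ] E k)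
    (hL : Function.Surjective L) :
    ∃ M : E k ≃L[ℝ] E k, (∀ z, M ((M : E k →L[ℝ] E k).adjoint z) = L (L.adjoint z)) ∧
      ∀ g : E k → ℝ≥0∞, Measurable g → ∫⁻ x, g (L (x : V)) ∂sphereMeasure V =
        ∫⁻ z, g z * (ENNReal.ofReal (projConst k d * |(M : E k →L[ℝ] E k).det|⁻¹) *
          projWeight d (M.symm z)) := by
  obtain ⟨M, W, hW, hLW, hM⟩ := exists_equiv_comp_coisometry L hL
  refine ⟨M, hM, fun g hg => ?_⟩
  have hgM : Measurable fun z => g (M z) := hg.comp M.continuous.measurable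
  have hdet : LinearMap.det (M : E k →L[ℝ] E k).toLinearMap ≠ 0 :=
    (LinearEquiv.isUnit_det' M.toLinearEquiv).ne_zero
  have hmap := Measure.map_linearMap_addHaar_eq_smul_addHaar (volume : Measure (E k)) hdet
  have hmeas : Measurable fun z => g z * projWeight d (M.symm z) :=
    hg.mul (measurable_projWeight.comp M.symm.continuous.measurable)
  have h1 : ∫⁻ z, g (M z) * projWeight d z =
      ∫⁻ z, g z * projWeight d (M.symm z) ∂(volume.map (M : E k →L[ℝ] E k).toLinearMap) := by
    rw [lintegral_map (g := ⇑(M : E k →L[ℝ] E k).toLinearMap) hmeas M.continuous.measurable]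
    refine lintegral_congr fun z => ?_
    change _ = g (M z) * projWeight d (M.symm (M z))
    rw [M.symm_apply_apply]
  simp_rw [hLW]
  rw [lintegral_sphereMeasure_coisometry hd hV W hW hgM, h1, hmap, lintegral_smul_measure,
    smul_eq_mul, ← mul_assoc, ← ENNReal.ofReal_mul (projConst_pos k (by omega)).le, abs_inv,
    ← lintegral_const_mul' _ _ ENNReal.ofReal_ne_top]
  refine lintegral_congr fun z => ?_
  rw [← mul_assoc, ← mul_assoc, mul_comm (g z)]

section Pair

variable {k : ℕ} {M N : E k ≃L[ℝ] E k} {T : E k →L[ℝ] E k} {τ : ℝ}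

theorem inner_self_of_mul_adjoint
    (hM : ∀ z, M ((M : E k →L[ℝ] E k).adjoint z) = T z) (u v : E k) :
    ⟪T u, v⟫_ℝ = ⟪(M : E k →L[ℝ] E k).adjoint u, (M : E k →L[ℝ] E k).adjoint v⟫_ℝ := by
  rw [ContinuousLinearMap.adjoint_inner_right, ← hM u]
  rfl

theorem det_adjoint_eq (S : E k →L[ℝ] E k) : S.adjoint.det = S.det := by
  have b := EuclideanSpace.basisFun (Fin k) ℝ
  rw [ContinuousLinearMap.det, ContinuousLinearMap.det, ← LinearMap.det_toMatrix b.toBasis,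
    ← LinearMap.det_toMatrix b.toBasis (S : E k →ₗ[ℝ] E k)]
  have := LinearMap.toMatrix_adjoint b b (S : E k →ₗ[ℝ] E k)
  have h2 : ((S.adjoint : E k →L[ℝ] E k) : E k →ₗ[ℝ] E k) =
      LinearMap.adjoint (S : E k →ₗ[ℝ] E k) := rfl
  rw [h2, this, Matrix.det_conjTranspose]
  simp

/-- A linear map that shrinks norms by the factor `r` has determinant at most `rᵏ`. -/
theorem abs_det_le_pow {S : E k →L[ℝ] E k} {r : ℝ} (hr : 0 < r) (hS : ∀ x, ‖S x‖ ≤ r * ‖x‖) :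
    |S.det| ≤ r ^ k := by
  have h := Measure.addHaar_image_linearMap (volume : Measure (E k)) S.toLinearMap (ball 0 1)
  have hsub : S.toLinearMap '' ball 0 1 ⊆ closedBall 0 r := by
    rintro _ ⟨x, hx, rfl⟩
    rw [mem_closedBall_zero_iff]
    rw [mem_ball_zero_iff] at hx
    exact (hS x).trans (by nlinarith)
  have h2 := measure_mono (μ := (volume : Measure (E k))) hsub
  rw [h, Measure.addHaar_closedBall _ _ hr.le, finrank_euclideanSpace_fin] at h2
  have h3 : (volume : Measure (E k)) (ball 0 1) ≠ 0 := (measure_ball_pos _ _ one_pos).ne'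
  rw [ENNReal.mul_le_mul_iff_left h3 measure_ball_lt_top.ne,
    ENNReal.ofReal_le_ofReal_iff (by positivity)] at h2
  exact h2

/-- If `T = M M*` and `1 - T = N N*`, then `(det M det N)² = det (T (1 - T)) ≤ 4⁻ᵏ`,
since `T (1 - T) = (1 - D²) / 4` with `D = 2 T - 1`. -/
theorem abs_det_mul_abs_det_le
    (hM : ∀ z, M ((M : E k →L[ℝ] E k).adjoint z) = T z)
    (hN : ∀ z, N ((N : E k →L[ℝ] E k).adjoint z) = z - T z)
    (hD : ∀ z, ‖(2 : ℝ) • T z - z‖ ≤ ‖z‖) :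
    (|(M : E k →L[ℝ] E k).det| * |(N : E k →L[ℝ] E k).det|) ^ 2 ≤ (1 / 4) ^ k := by
  set S : E k →L[ℝ] E k := ((M : E k →L[ℝ] E k) ∘L (M : E k →L[ℝ] E k).adjoint) ∘L
    ((N : E k →L[ℝ] E k) ∘L (N : E k →L[ℝ] E k).adjoint) with hSdef
  have hS : ∀ z, S z = T (z - T z) := by
    intro z
    rw [← hN z, ← hM]; rfl
  have hdet : |S.det| = (|(M : E k →L[ℝ] E k).det| * |(N : E k →L[ℝ] E k).det|) ^ 2 := by
    have h := fun A B : E k →L[ℝ] E k => LinearMap.det_comp (A : E k →ₗ[ℝ] E k) (B : E k →ₗ[ℝ] E k)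
    have h' : ∀ A B : E k →L[ℝ] E k, (A ∘L B).det = A.det * B.det := h
    rw [hSdef, h', h', h', det_adjoint_eq, det_adjoint_eq, abs_mul, abs_mul, abs_mul]
    ring
  rw [← hdet]
  refine abs_det_le_pow (by norm_num) fun z => ?_
  have hsymm : ∀ u v, ⟪T u, v⟫_ℝ = ⟪u, T v⟫_ℝ := by
    intro u v
    rw [inner_self_of_mul_adjoint hM, real_inner_comm (T v) u, inner_self_of_mul_adjoint hM,
      real_inner_comm]
  set y := (2 : ℝ) • T z - z with hy
  have hTy : S z = (1 / 4 : ℝ) • (z - ((2 : ℝ) • T y - y)) := by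
    rw [hS, hy]; simp only [map_sub, map_smul]; module
  have h1 := hD y
  have h2 : ⟪z, (2 : ℝ) • T y - y⟫_ℝ = ‖y‖ ^ 2 := by
    rw [inner_sub_right, inner_smul_right, ← hsymm, ← real_inner_self_eq_norm_sq]
    conv_rhs => rw [hy]
    rw [← hy, inner_sub_left, inner_smul_left]; simp
  have h3 : ‖z - ((2 : ℝ) • T y - y)‖ ^ 2 ≤ ‖z‖ ^ 2 := by
    rw [@norm_sub_sq_real, h2]
    nlinarith [norm_nonneg ((2 : ℝ) • T y - y), norm_nonneg y]
  rw [hTy, norm_smul, Real.norm_of_nonneg (by norm_num)]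
  have := (sq_le_sq₀ (norm_nonneg _) (norm_nonneg _)).mp h3
  linarith

theorem exists_preimage_of_near (hτ : τ < 1)
    (hD : ∀ z, ‖(2 : ℝ) • T z - z‖ ≤ τ * ‖z‖) (z : E k) : ∃ u, T u = z := by
  have hinj : Function.Injective T.toLinearMap := by
    rw [injective_iff_map_eq_zero]
    intro u hu
    have hu : T u = 0 := hu
    have := hD u
    rw [hu, smul_zero, zero_sub, norm_neg] at this
    exact norm_eq_zero.mp (le_antisymm (by nlinarith [norm_nonneg u]) (norm_nonneg u))
  exact LinearMap.surjective_of_injective hinj z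

theorem inner_ge_of_near (hD : ∀ z, ‖(2 : ℝ) • T z - z‖ ≤ τ * ‖z‖) (u : E k) :
    (1 - τ) / 2 * ‖u‖ ^ 2 ≤ ⟪T u, u⟫_ℝ := by
  have h1 := abs_le.mp (abs_real_inner_le_norm ((2 : ℝ) • T u - u) u)
  rw [inner_sub_left, inner_smul_left, real_inner_self_eq_norm_sq] at h1
  have h2 := mul_le_mul_of_nonneg_right (hD u) (norm_nonneg u)
  simp only [conj_trivial] at h1
  nlinarith [h1.1]

/-- For `T = M M*` the right-hand side is `⟨T⁻¹ z, z⟩`, with `T⁻¹ z` given as a solution `u`. -/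
theorem norm_symm_sq_eq (hM : ∀ z, M ((M : E k →L[ℝ] E k).adjoint z) = T z) {u z : E k}
    (hu : T u = z) : ‖M.symm z‖ ^ 2 = ⟪u, z⟫_ℝ := by
  have h1 : M.symm z = (M : E k →L[ℝ] E k).adjoint u := by
    rw [← hu, ← hM, M.symm_apply_apply]
  rw [h1, ← real_inner_self_eq_norm_sq, ← inner_self_of_mul_adjoint hM, hu, real_inner_comm]

theorem norm_symm_sq_le (hM : ∀ z, M ((M : E k →L[ℝ] E k).adjoint z) = T z) (hτ : τ ≤ 1 / 2)
    (hD : ∀ z, ‖(2 : ℝ) • T z - z‖ ≤ τ * ‖z‖) (z : E k) :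
    ‖M.symm z‖ ^ 2 ≤ 4 * ‖z‖ ^ 2 := by
  obtain ⟨u, hu⟩ := exists_preimage_of_near (by linarith) hD z
  have h1 := inner_ge_of_near hD u
  rw [norm_symm_sq_eq hM hu]
  rw [hu, real_inner_comm] at h1
  have h2 := real_inner_le_norm u z
  have h3 : ‖u‖ ≤ 4 * ‖z‖ := by
    by_contra! h
    nlinarith [norm_nonneg z, norm_nonneg u,
      mul_pos (by nlinarith [norm_nonneg z] : 0 < ‖u‖) (sub_pos.mpr h),
      sq_nonneg ‖u‖]
  nlinarith [norm_nonneg z]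

/-- The terms of first order in `D = 2 T - 1` cancel in `⟨T⁻¹ z, z⟩ + ⟨(1 - T)⁻¹ z, z⟩`, which is
`4 ⟨(1 - D²)⁻¹ z, z⟩`. -/
theorem norm_symm_sq_add_le
    (hM : ∀ z, M ((M : E k →L[ℝ] E k).adjoint z) = T z)
    (hN : ∀ z, N ((N : E k →L[ℝ] E k).adjoint z) = z - T z) (hτ0 : 0 ≤ τ) (hτ : τ ≤ 1 / 2)
    (hD : ∀ z, ‖(2 : ℝ) • T z - z‖ ≤ τ * ‖z‖) (z : E k) :
    ‖M.symm z‖ ^ 2 + ‖N.symm z‖ ^ 2 ≤ 4 * (1 + 4 / 3 * τ ^ 2) * ‖z‖ ^ 2 := by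
  have hD' : ∀ z, ‖(2 : ℝ) • (ContinuousLinearMap.id ℝ (E k) - T) z - z‖ ≤ τ * ‖z‖ := by
    intro z
    convert! hD z using 1
    rw [← norm_neg]; congr 1
    simp only [sub_apply, ContinuousLinearMap.id_apply]; module
  obtain ⟨u, hu⟩ := exists_preimage_of_near (by linarith) hD z
  obtain ⟨v, hv⟩ := exists_preimage_of_near (by linarith) hD' z
  rw [norm_symm_sq_eq hM hu,
    norm_symm_sq_eq (T := ContinuousLinearMap.id ℝ (E k) - T) (fun z => hN z) hv,
    ← inner_add_left]
  set y := u + v with hy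
  have hv' : v - T v = z := hv
  have hTy : T y - T (T y) = z := by
    have e : T y - T (T y) = (T u - T (T u)) + T (v - T v) := by
      rw [hy]; simp only [map_add, map_sub]; abel
    rw [e, hv', hu]; abel
  set y' := (2 : ℝ) • T y - y with hy'
  have h4 : (4 : ℝ) • z = y - ((2 : ℝ) • T y' - y') := by
    rw [← hTy, hy']; simp only [map_sub, map_smul]; module
  have h5 : ‖y‖ ≤ 4 * ‖z‖ + τ ^ 2 * ‖y‖ := by
    have e : y = (4 : ℝ) • z + ((2 : ℝ) • T y' - y') := by rw [h4]; abel
    calc ‖y‖ ≤ ‖(4 : ℝ) • z‖ + ‖(2 : ℝ) • T y' - y'‖ := by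
          conv_lhs => rw [e]
          exact norm_add_le _ _
      _ ≤ 4 * ‖z‖ + τ * (τ * ‖y‖) := by
          rw [norm_smul, Real.norm_of_nonneg (by norm_num)]
          gcongr
          exact (hD y').trans (by gcongr; exact hD y)
      _ = _ := by ring
  have h6 : ‖y‖ ≤ 4 * (1 + 4 / 3 * τ ^ 2) * ‖z‖ := by
    have : τ ^ 2 ≤ 1 / 4 := by nlinarith
    have h7 : 1 ≤ (1 + 4 / 3 * τ ^ 2) * (1 - τ ^ 2) := by nlinarith [sq_nonneg τ]
    nlinarith [mul_le_mul_of_nonneg_right h7 (norm_nonneg y), sq_nonneg τ]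
  calc ⟪y, z⟫_ℝ ≤ ‖y‖ * ‖z‖ := real_inner_le_norm _ _
    _ ≤ 4 * (1 + 4 / 3 * τ ^ 2) * ‖z‖ * ‖z‖ := by gcongr
    _ = _ := by ring

end Pair

/-! ### Comparison of normalizing constants and of weights -/

/-- A lower bound for the growth of the Gamma function, by log-convexity. -/
theorem Gamma_mul_rpow_le_Gamma_add {x s : ℝ} (hx : 1 < x) (hs : 0 ≤ s) :
    Real.Gamma x * (x - 1) ^ s ≤ Real.Gamma (x + s) := by
  rcases hs.eq_or_lt with rfl | hs
  · simp
  have h1 : 0 < Real.Gamma x := Real.Gamma_pos_of_pos (by linarith)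
  have h2 : 0 < Real.Gamma (x - 1) := Real.Gamma_pos_of_pos (by linarith)
  have h3 : 0 < Real.Gamma (x + s) := Real.Gamma_pos_of_pos (by linarith)
  have h := Real.convexOn_log_Gamma.slope_mono_adjacent (x := x - 1) (y := x) (z := x + s)
    (Set.mem_Ioi.mpr (by linarith)) (Set.mem_Ioi.mpr (by linarith)) (by linarith) (by linarith)
  have e : Real.Gamma x = (x - 1) * Real.Gamma (x - 1) := by
    rw [← Real.Gamma_add_one (by linarith), sub_add_cancel]
  have e' : Real.log (Real.Gamma x) = Real.log (x - 1) + Real.log (Real.Gamma (x - 1)) := by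
    rw [e, Real.log_mul (by linarith) h2.ne']
  simp only [Function.comp_apply, sub_sub_cancel, div_one, add_sub_cancel_left] at h
  rw [le_div_iff₀ hs] at h
  rw [← Real.log_le_log_iff (by have := Real.rpow_pos_of_pos (sub_pos.mpr hx) s; positivity) h3,
    Real.log_mul h1.ne' (Real.rpow_pos_of_pos (sub_pos.mpr hx) s).ne',
    Real.log_rpow (sub_pos.mpr hx)]
  have : Real.log (x - 1) * s = (Real.log (Real.Gamma x) - Real.log (Real.Gamma (x - 1))) * s := by
    rw [e']; ring
  linarith

/-- An upper bound for the growth of the Gamma function, by log-convexity. -/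
theorem Gamma_add_le_Gamma_mul_rpow {x s : ℝ} (hx : 0 < x) (hs : 0 ≤ s) :
    Real.Gamma (x + s) ≤ Real.Gamma x * (x + s) ^ s := by
  rcases hs.eq_or_lt with rfl | hs
  · simp
  have hxs : 0 < x + s := by linarith
  have h1 : 0 < Real.Gamma x := Real.Gamma_pos_of_pos hx
  have h3 : 0 < Real.Gamma (x + s) := Real.Gamma_pos_of_pos hxs
  have h := Real.convexOn_log_Gamma.slope_mono_adjacent (x := x) (y := x + s) (z := x + s + 1)
    (Set.mem_Ioi.mpr hx) (Set.mem_Ioi.mpr (by linarith)) (by linarith) (by linarith)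
  simp only [Function.comp_apply, add_sub_cancel_left, div_one] at h
  rw [Real.Gamma_add_one hxs.ne', Real.log_mul hxs.ne' h3.ne', div_le_iff₀ hs] at h
  rw [← Real.log_le_log_iff h3 (by have := Real.rpow_pos_of_pos hxs s; positivity),
    Real.log_mul h1.ne' (Real.rpow_pos_of_pos hxs s).ne', Real.log_rpow hxs]
  linarith

theorem le_projConst {k d : ℕ} (hd : 3 ≤ d) :
    (((d : ℝ) / 2 - 1) / Real.pi) ^ ((k : ℝ) / 2) ≤ projConst k d := by
  have hd' : (3 : ℝ) ≤ d := by exact_mod_cast hd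
  have h := Gamma_mul_rpow_le_Gamma_add (x := (d : ℝ) / 2) (s := (k : ℝ) / 2) (by linarith)
    (by positivity)
  have h2 : 0 < Real.Gamma ((d : ℝ) / 2) := Real.Gamma_pos_of_pos (by linarith)
  have h3 := Real.rpow_pos_of_pos Real.pi_pos ((k : ℝ) / 2)
  rw [projConst, Real.div_rpow (by linarith) Real.pi_pos.le, div_le_div_iff₀ h3 (by positivity)]
  have e : ((k + d : ℕ) : ℝ) / 2 = (d : ℝ) / 2 + (k : ℝ) / 2 := by push_cast; ring
  rw [e]
  nlinarith

theorem projConst_le {k d : ℕ} (hd : 0 < d) :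
    projConst k d ≤ (((k + d : ℕ) : ℝ) / 2 / Real.pi) ^ ((k : ℝ) / 2) := by
  have hd' : (0 : ℝ) < d := by exact_mod_cast hd
  have h := Gamma_add_le_Gamma_mul_rpow (x := (d : ℝ) / 2) (s := (k : ℝ) / 2) (by linarith)
    (by positivity)
  have h2 : 0 < Real.Gamma ((d : ℝ) / 2) := Real.Gamma_pos_of_pos (by linarith)
  have h3 := Real.rpow_pos_of_pos Real.pi_pos ((k : ℝ) / 2)
  have e : ((k + d : ℕ) : ℝ) / 2 = (d : ℝ) / 2 + (k : ℝ) / 2 := by push_cast; ring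
  rw [projConst, Real.div_rpow (by positivity) Real.pi_pos.le, div_le_div_iff₀ (by positivity) h3,
    e]
  nlinarith

/-- The normalizing constants in the dimensions `n / 2` and `n`, compared by Bernoulli's
inequality. -/
theorem projConst_mul_ge {k d dA dB : ℕ} (hA : 3 ≤ dA) (hB : 3 ≤ dB) (hd : 0 < d) {q : ℝ}
    (hq : q ≤ 1)
    (hqA : (1 - q) * ((k + d : ℕ) : ℝ) ≤ 2 * (dA - 2))
    (hqB : (1 - q) * ((k + d : ℕ) : ℝ) ≤ 2 * (dB - 2)) :
    (1 - k * q) * projConst k d ^ 2 ≤ 2 ^ k * (projConst k dA * projConst k dB) := by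
  have hA' : (3 : ℝ) ≤ dA := by exact_mod_cast hA
  have hB' : (3 : ℝ) ≤ dB := by exact_mod_cast hB
  have hn : (0 : ℝ) < ((k + d : ℕ) : ℝ) := by exact_mod_cast (by omega : 0 < k + d)
  -- A common lower bound for `dA / 2 - 1` and `dB / 2 - 1`.
  set x : ℝ := (1 - q) * ((k + d : ℕ) : ℝ) / 4 with hx
  have hx0 : 0 ≤ x := by have := sub_nonneg.mpr hq; positivity
  have hpow : ∀ y : ℝ, 0 ≤ y → (y ^ ((k : ℝ) / 2)) * (y ^ ((k : ℝ) / 2)) = y ^ k := by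
    intro y hy
    rw [← Real.rpow_add_of_nonneg hy (by positivity) (by positivity), add_halves,
      Real.rpow_natCast]
  have hcA : (x / Real.pi) ^ ((k : ℝ) / 2) ≤ projConst k dA :=
    (Real.rpow_le_rpow (by positivity) (by gcongr; linarith) (by positivity)).trans
      (le_projConst hA)
  have hcB : (x / Real.pi) ^ ((k : ℝ) / 2) ≤ projConst k dB :=
    (Real.rpow_le_rpow (by positivity) (by gcongr; linarith) (by positivity)).trans
      (le_projConst hB)
  have hc := projConst_le (k := k) hd
  have hc0 := (projConst_pos k hd).le
  have h1 : (x / Real.pi) ^ k ≤ projConst k dA * projConst k dB := by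
    rw [← hpow _ (by positivity)]
    exact mul_le_mul hcA hcB (by positivity) (projConst_pos k (by omega)).le
  have h2 : projConst k d ^ 2 ≤ (((k + d : ℕ) : ℝ) / 2 / Real.pi) ^ k := by
    rw [← hpow _ (by positivity), sq]
    exact mul_le_mul hc hc hc0 (by positivity)
  have h3 : 1 - k * q ≤ (1 - q) ^ k := by
    have := one_add_mul_le_pow (a := -q) (by linarith) k
    calc 1 - k * q = 1 + k * (-q) := by ring
      _ ≤ (1 + -q) ^ k := this
      _ = _ := by ring
  calc (1 - k * q) * projConst k d ^ 2
      ≤ (1 - q) ^ k * (((k + d : ℕ) : ℝ) / 2 / Real.pi) ^ k :=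
        mul_le_mul h3 h2 (by positivity) (pow_nonneg (by linarith) _)
    _ = 2 ^ k * (x / Real.pi) ^ k := by
        rw [← mul_pow, ← mul_pow]; congr 1; rw [hx]; ring
    _ ≤ _ := by gcongr

/-- The comparison of the weights: with `a + b` close to `4 s`, the product
`(1 - a) ^ (n / 4) * (1 - b) ^ (n / 4)` is close to `(1 - s) ^ n`. -/
theorem rpow_mul_rpow_ge {a b s n k pA pB p t : ℝ} (ha : 0 ≤ a) (hb : 0 ≤ b) (hs : 0 ≤ s)
    (ha4 : a ≤ 4 * s) (hb4 : b ≤ 4 * s) (hs8 : s ≤ 1 / 8) (hab : a + b ≤ 4 * (1 + t) * s)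
    (hpA : 0 ≤ pA) (hpB : 0 ≤ pB) (hpA' : pA ≤ n / 4) (hpB' : pB ≤ n / 4)
    (hp : n - k - 2 ≤ 2 * p) (hp0 : 0 ≤ p) :
    Real.exp (-(n * (t * s + 16 * s ^ 2) + (k + 2) * s)) * ((1 - s) ^ p) ^ 2 ≤
      (1 - a) ^ pA * (1 - b) ^ pB := by
  have hlog : ∀ y : ℝ, 0 ≤ y → y ≤ 1 / 2 → -(y + 2 * y ^ 2) ≤ Real.log (1 - y) := by
    intro y hy hy2
    have h1 := Real.one_sub_inv_le_log_of_pos (x := 1 - y) (by linarith)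
    refine le_trans ?_ h1
    have h2 : (1 - y)⁻¹ ≤ 1 + y + 2 * y ^ 2 := by
      rw [inv_le_iff_one_le_mul₀ (by linarith)]
      nlinarith [mul_nonneg (sq_nonneg y) (by linarith : (0 : ℝ) ≤ 1 - 2 * y)]
    linarith
  have hlogs : Real.log (1 - s) ≤ -s := by
    have := Real.log_le_sub_one_of_pos (x := 1 - s) (by linarith)
    linarith
  have h1 := hlog a ha (by linarith)
  have h2 := hlog b hb (by linarith)
  rw [Real.rpow_def_of_pos (by linarith : 0 < 1 - s),
    Real.rpow_def_of_pos (by linarith : 0 < 1 - a),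
    Real.rpow_def_of_pos (by linarith : 0 < 1 - b), ← Real.exp_nat_mul, ← Real.exp_add,
    ← Real.exp_add, Real.exp_le_exp]
  have hn : 0 ≤ n := by linarith
  have e1 : -(n / 4 * (a + 2 * a ^ 2)) ≤ Real.log (1 - a) * pA := by
    nlinarith [mul_le_mul_of_nonneg_right h1 hpA,
      mul_le_mul_of_nonneg_right hpA' (by positivity : 0 ≤ a + 2 * a ^ 2)]
  have e2 : -(n / 4 * (b + 2 * b ^ 2)) ≤ Real.log (1 - b) * pB := by
    nlinarith [mul_le_mul_of_nonneg_right h2 hpB,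
      mul_le_mul_of_nonneg_right hpB' (by positivity : 0 ≤ b + 2 * b ^ 2)]
  have e3 : ((2 : ℕ) : ℝ) * (Real.log (1 - s) * p) ≤ -((n - k - 2) * s) := by
    push_cast
    nlinarith [mul_le_mul_of_nonneg_right hlogs hp0, mul_le_mul_of_nonneg_right hp hs]
  have e4 : a ^ 2 ≤ 16 * s ^ 2 := by nlinarith
  have e5 : b ^ 2 ≤ 16 * s ^ 2 := by nlinarith
  have e6 : n / 4 * (a + 2 * a ^ 2) + n / 4 * (b + 2 * b ^ 2) ≤
      n / 4 * (4 * (1 + t) * s + 64 * s ^ 2) := by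
    rw [← mul_add]
    exact mul_le_mul_of_nonneg_left (by linarith) (by linarith)
  nlinarith

/-- A Cauchy–Schwarz inequality for a function dominated by a geometric mean. -/
theorem mul_sq_setLIntegral_le {α : Type*} [MeasurableSpace α] {μ : Measure α} {S : Set α}
    {F A B : α → ℝ≥0∞} (hF : Measurable F) (hA : Measurable A) (hB : Measurable B) {c : ℝ≥0∞}
    (h : ∀ x ∈ S, c * F x ^ 2 ≤ A x * B x) :
    c * (∫⁻ x in S, F x ∂μ) ^ 2 ≤ (∫⁻ x, A x ∂μ) * ∫⁻ x, B x ∂μ := by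
  have hhalf : ∀ y : ℝ≥0∞, (y ^ (1 / 2 : ℝ)) ^ 2 = y := by
    intro y
    rw [← ENNReal.rpow_natCast, ← ENNReal.rpow_mul]; norm_num
  have h1 : c ^ (1 / 2 : ℝ) * ∫⁻ x in S, F x ∂μ ≤
      (∫⁻ x, A x ∂μ) ^ (1 / 2 : ℝ) * (∫⁻ x, B x ∂μ) ^ (1 / 2 : ℝ) := by
    have hpq : Real.HolderConjugate 2 2 := Real.HolderConjugate.two_two
    have h2 := ENNReal.lintegral_mul_le_Lp_mul_Lq μ hpq (f := fun x => A x ^ (1 / 2 : ℝ))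
      (g := fun x => B x ^ (1 / 2 : ℝ)) (by fun_prop) (by fun_prop)
    have h3 : ∀ y : ℝ≥0∞, (y ^ (1 / 2 : ℝ)) ^ (2 : ℝ) = y := by
      intro y
      rw [← ENNReal.rpow_mul]; norm_num
    simp only [h3] at h2
    refine le_trans ?_ h2
    rw [← lintegral_const_mul _ hF]
    refine (setLIntegral_mono (by fun_prop) fun x hx => ?_).trans (setLIntegral_le_lintegral S _)
    have h4 := ENNReal.rpow_le_rpow (h x hx) (by norm_num : (0 : ℝ) ≤ 1 / 2)
    rw [ENNReal.mul_rpow_of_nonneg _ _ (by norm_num), ENNReal.mul_rpow_of_nonneg _ _ (by norm_num),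
      ← ENNReal.rpow_natCast, ← ENNReal.rpow_mul] at h4
    norm_num at h4 ⊢
    exact h4
  have h5 := pow_le_pow_left' h1 2
  rwa [mul_pow, mul_pow, hhalf, hhalf, hhalf] at h5

/-! ### The densities for a subspace and for its complement -/

/-- The inclusion of `ℝᵏ` into `ℝⁿ` as the first coordinates. -/
noncomputable def coordEmb (n k : ℕ) : E k →L[ℝ] E n :=
  LinearMap.toContinuousLinearMap
    { toFun := fun z => WithLp.toLp 2 fun j => if h : (j : ℕ) < k then z ⟨j, h⟩ else 0
      map_add' := fun z w => by
        ext j; by_cases h : (j : ℕ) < k <;> simp [h]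
      map_smul' := fun c z => by
        ext j; by_cases h : (j : ℕ) < k <;> simp [h] }

/-- The projection of `ℝⁿ` to the first `k` coordinates. -/
noncomputable def coordProj (n k : ℕ) : E n →L[ℝ] E k := (coordEmb n k).adjoint

theorem coordEmb_apply {n k : ℕ} (z : E k) (j : Fin n) :
    coordEmb n k z j = if h : (j : ℕ) < k then z ⟨j, h⟩ else 0 := rfl

theorem adjoint_coordProj (n k : ℕ) : (coordProj n k).adjoint = coordEmb n k :=
  ContinuousLinearMap.adjoint_adjoint _

theorem coordProj_apply {n k : ℕ} (hk : k ≤ n) (x : E n) (i : Fin k) :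
    coordProj n k x i = x (Fin.castLE hk i) := by
  have h1 : coordProj n k x i = ⟪EuclideanSpace.single i (1 : ℝ), coordProj n k x⟫_ℝ := by
    simp [EuclideanSpace.inner_single_left]
  rw [h1, coordProj, ContinuousLinearMap.adjoint_inner_right]
  have h2 : coordEmb n k (EuclideanSpace.single i (1 : ℝ)) =
      EuclideanSpace.single (Fin.castLE hk i) (1 : ℝ) := by
    ext j
    rw [coordEmb_apply]
    by_cases h : (j : ℕ) < k
    · simp [h, Fin.ext_iff]
    · have : j ≠ Fin.castLE hk i := by
        intro e; apply h; rw [e]; exact i.2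
      simp [h, this]
  rw [h2, EuclideanSpace.inner_single_left]
  simp

theorem coordProj_coordEmb {n k : ℕ} (hk : k ≤ n) (z : E k) :
    coordProj n k (coordEmb n k z) = z := by
  ext i
  rw [coordProj_apply hk, coordEmb_apply]
  simp

theorem norm_coordEmb {n k : ℕ} (hk : k ≤ n) (z : E k) : ‖coordEmb n k z‖ = ‖z‖ := by
  rw [← sq_eq_sq₀ (norm_nonneg _) (norm_nonneg _), ← real_inner_self_eq_norm_sq,
    ← real_inner_self_eq_norm_sq, ← ContinuousLinearMap.adjoint_inner_right]
  change ⟪z, coordProj n k (coordEmb n k z)⟫_ℝ = _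
  rw [coordProj_coordEmb hk]

/-- The compression of an operator of `ℝⁿ` to the first `k` coordinates. -/
noncomputable def compression {n : ℕ} (k : ℕ) (A : E n →L[ℝ] E n) : E k →L[ℝ] E k :=
  coordProj n k ∘L A ∘L coordEmb n k

theorem compression_apply {n k : ℕ} (A : E n →L[ℝ] E n) (z : E k) :
    compression k A z = coordProj n k (A (coordEmb n k z)) := rfl

theorem coordProj_subtype_mul_adjoint {n k : ℕ} (H : Submodule ℝ (E n)) (z : E k) :
    (coordProj n k ∘L H.subtypeL) ((coordProj n k ∘L H.subtypeL).adjoint z) =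
      compression k H.starProjection z := by
  rw [ContinuousLinearMap.adjoint_comp, adjoint_coordProj, Submodule.adjoint_subtypeL]
  rfl

theorem compression_orthogonal {n k : ℕ} (hk : k ≤ n) (H : Submodule ℝ (E n)) (z : E k) :
    compression k Hᗮ.starProjection z = z - compression k H.starProjection z := by
  rw [compression_apply, Submodule.starProjection_orthogonal_val, map_sub, coordProj_coordEmb hk]
  rfl

theorem lintegral_subspaceSphereMeasure {n k : ℕ} (H : Submodule ℝ (E n)) {g : E k → ℝ≥0∞}
    (hg : Measurable g) :
    ∫⁻ x, g (coordProj n k (x : E n)) ∂subspaceSphereMeasure H =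
      ∫⁻ x, g ((coordProj n k ∘L H.subtypeL) (x : H)) ∂sphereMeasure H := by
  rw [subspaceSphereMeasure, lintegral_map
    (f := fun x : sphere (0 : E n) 1 => g (coordProj n k (x : E n))) (by fun_prop)
    (measurable_sphereInclusion H)]
  rfl

/-- The density of the first `k` coordinates of a uniform point of the sphere of `H`, if the
compression of the projection to `H` is near `1/2`. -/
theorem exists_density_subspace {n k d : ℕ} (H : Submodule ℝ (E n)) (hd : 3 ≤ d)
    (hH : Module.finrank ℝ H = k + d) {τ : ℝ} (hτ : τ < 1)
    (hD : ∀ z, ‖(2 : ℝ) • compression k H.starProjection z - z‖ ≤ τ * ‖z‖) :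
    ∃ M : E k ≃L[ℝ] E k,
      (∀ z, M ((M : E k →L[ℝ] E k).adjoint z) = compression k H.starProjection z) ∧
      ∀ g : E k → ℝ≥0∞, Measurable g →
        ∫⁻ x, g (coordProj n k (x : E n)) ∂subspaceSphereMeasure H =
        ∫⁻ z, g z * (ENNReal.ofReal (projConst k d * |(M : E k →L[ℝ] E k).det|⁻¹) *
          projWeight d (M.symm z)) := by
  have hsurj : Function.Surjective (coordProj n k ∘L H.subtypeL) := by
    intro z
    obtain ⟨u, hu⟩ := exists_preimage_of_near hτ hD z
    exact ⟨_, (coordProj_subtype_mul_adjoint H u).trans hu⟩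
  obtain ⟨M, hM, hg⟩ := exists_density_of_surjective hd hH _ hsurj
  refine ⟨M, fun z => (hM z).trans (coordProj_subtype_mul_adjoint H z), fun g hgm => ?_⟩
  rw [lintegral_subspaceSphereMeasure H hgm, hg g hgm]

theorem lintegral_coordProj {n k d : ℕ} (hd : 3 ≤ d) (hn : n = k + d) {g : E k → ℝ≥0∞}
    (hg : Measurable g) :
    ∫⁻ x, g (coordProj n k (x : E n)) ∂sphereMeasure (E n) =
      ENNReal.ofReal (projConst k d) * ∫⁻ z, g z * projWeight d z :=
  lintegral_sphereMeasure_coisometry hd (by rw [finrank_euclideanSpace_fin, hn]) _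
    (fun z => by rw [adjoint_coordProj, coordProj_coordEmb (by omega)]) hg

/-- The law of the first `k` coordinates under `σ_H` is absolutely continuous with respect to the
law under the uniform measure of `Sⁿ⁻¹`. -/
theorem lintegral_subspace_eq_zero {n k d d' : ℕ} (H : Submodule ℝ (E n)) (hd : 3 ≤ d)
    (hH : Module.finrank ℝ H = k + d) (hd' : 3 ≤ d') (hn : n = k + d') {τ : ℝ} (hτ : τ < 1)
    (hD : ∀ z, ‖(2 : ℝ) • compression k H.starProjection z - z‖ ≤ τ * ‖z‖)
    {g : E k → ℝ≥0∞} (hg : Measurable g)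
    (h0 : ∫⁻ x, g (coordProj n k (x : E n)) ∂sphereMeasure (E n) = 0) :
    ∫⁻ x, g (coordProj n k (x : E n)) ∂subspaceSphereMeasure H = 0 := by
  obtain ⟨M, hM, hgM⟩ := exists_density_subspace H hd hH hτ hD
  have hdpos : ∀ {e : ℕ}, 3 ≤ e → 0 < ((e : ℝ) - 2) / 2 := by
    intro e he
    have : (3 : ℝ) ≤ e := by exact_mod_cast he
    linarith
  rw [lintegral_coordProj hd' hn hg, mul_eq_zero] at h0
  have h1 := h0.resolve_left (by simpa using projConst_pos k (by omega))
  rw [lintegral_eq_zero_iff (by fun_prop)] at h1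
  have hmeas : Measurable fun z : E k => projWeight d (M.symm z) :=
    measurable_projWeight.comp M.symm.continuous.measurable
  rw [hgM g hg, lintegral_eq_zero_iff (by fun_prop)]
  filter_upwards [h1] with z hz
  have hz : g z * projWeight d' z = 0 := hz
  simp only [Pi.zero_apply]
  rcases mul_eq_zero.mp hz with hz | hz
  · rw [hz, zero_mul]
  -- The vanishing of the weight at `z` means `1 ≤ ‖z‖`, and `‖M‖ ≤ 1`.
  have hz1 : 1 ≤ ‖z‖ := by
    rw [projWeight, ENNReal.rpow_eq_zero_iff_of_pos (hdpos hd'), ENNReal.ofReal_eq_zero] at hz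
    nlinarith [norm_nonneg z]
  have hMn : ‖(M : E k →L[ℝ] E k)‖ ≤ 1 := by
    rw [← LinearIsometryEquiv.norm_map ContinuousLinearMap.adjoint (M : E k →L[ℝ] E k)]
    refine ContinuousLinearMap.opNorm_le_bound _ zero_le_one fun w => ?_
    have h2 := inner_self_of_mul_adjoint hM w w
    rw [real_inner_self_eq_norm_sq] at h2
    have h3 := real_inner_le_norm ((2 : ℝ) • compression k H.starProjection w - w) w
    rw [inner_sub_left, inner_smul_left, h2, real_inner_self_eq_norm_sq, conj_trivial] at h3
    have h4 := mul_le_mul_of_nonneg_right (hD w) (norm_nonneg w)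
    rw [one_mul, ← sq_le_sq₀ (norm_nonneg _) (norm_nonneg _)]
    nlinarith [mul_nonneg (norm_nonneg w) (norm_nonneg w)]
  have hz2 : 1 ≤ ‖M.symm z‖ := by
    have h5 := (M : E k →L[ℝ] E k).le_of_opNorm_le hMn (M.symm z)
    have h6 : (M : E k →L[ℝ] E k) (M.symm z) = z := M.apply_symm_apply z
    rw [h6, one_mul] at h5
    exact hz1.trans h5
  have h7 : projWeight d (M.symm z) = 0 := by
    rw [projWeight, ENNReal.rpow_eq_zero_iff_of_pos (hdpos hd), ENNReal.ofReal_eq_zero]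
    nlinarith
  rw [h7, mul_zero, mul_zero]

theorem projWeight_eq_ofReal {k d : ℕ} {z : E k} (hz : ‖z‖ ^ 2 < 1) :
    projWeight d z = ENNReal.ofReal ((1 - ‖z‖ ^ 2) ^ (((d : ℝ) - 2) / 2)) := by
  rw [projWeight, ENNReal.ofReal_rpow_of_pos (by linarith)]

/-- The comparisons of the normalizing constants, the determinants and the weights, multiplied. -/
theorem mul_density_sq_le {κ c cA cB w wA wB e e₀ x δM δN r : ℝ} (hκ0 : 0 ≤ κ)
    (hκ : κ ≤ x * e₀) (he0 : 0 < e₀) (hee : e₀ ≤ e) (hcA : 0 ≤ cA) (hcB : 0 ≤ cB)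
    (hc : x * c ^ 2 ≤ r * (cA * cB)) (hr : r ≤ δM⁻¹ * δN⁻¹) (hw : e * w ^ 2 ≤ wA * wB) :
    κ * (c * w) ^ 2 ≤ (cA * δM⁻¹ * wA) * (cB * δN⁻¹ * wB) := by
  have hx : 0 ≤ x := (mul_nonneg_iff_of_pos_right he0).mp (hκ0.trans hκ)
  have he : 0 < e := he0.trans_le hee
  calc κ * (c * w) ^ 2 ≤ (x * e₀) * (c * w) ^ 2 := by gcongr
    _ ≤ (x * e) * (c * w) ^ 2 := by gcongr
    _ = (x * c ^ 2) * (e * w ^ 2) := by ring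
    _ ≤ (r * (cA * cB)) * (wA * wB) :=
      mul_le_mul hc hw (by positivity) ((by positivity : 0 ≤ x * c ^ 2).trans hc)
    _ ≤ ((δM⁻¹ * δN⁻¹) * (cA * cB)) * (wA * wB) := by
      have h : 0 ≤ wA * wB := (by positivity : 0 ≤ e * w ^ 2).trans hw
      gcongr
    _ = _ := by ring

/-- The geometric mean of the densities for `H` and for `Hᗮ` is at least `√κ` times the density for
`ℝⁿ` where `‖z‖² ≤ s₀`, in integrated form. The factor `1 - k q` comes from the normalizing
constants and the exponential from the weights. -/
theorem mul_sq_lintegral_le_mul_lintegral {n k d m : ℕ} (H : Submodule ℝ (E n)) (hd : 3 + k ≤ m)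
    (hm : m = n / 2) (hH : Module.finrank ℝ H = m) (hn : n = k + d) {τ q s₀ : ℝ} (hτ0 : 0 ≤ τ)
    (hτ : τ ≤ 1 / 2)
    (hD : ∀ z, ‖(2 : ℝ) • compression k H.starProjection z - z‖ ≤ τ * ‖z‖)
    (hq : q ≤ 1) (hq' : 2 * (k : ℝ) + 5 ≤ q * n) (hs0 : s₀ ≤ 1 / 8) {κ : ℝ} (hκ0 : 0 ≤ κ)
    (hκ : κ ≤ (1 - k * q) *
      Real.exp (-(n * (4 / 3 * τ ^ 2 * s₀ + 16 * s₀ ^ 2) + (k + 2) * s₀)))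
    {g : E k → ℝ≥0∞} (hg : Measurable g) :
    ENNReal.ofReal κ * (∫⁻ x, {z | ‖z‖ ^ 2 ≤ s₀}.indicator g (coordProj n k (x : E n))
      ∂sphereMeasure (E n)) ^ 2 ≤
      (∫⁻ x, g (coordProj n k (x : E n)) ∂subspaceSphereMeasure H) *
        ∫⁻ x, g (coordProj n k (x : E n)) ∂subspaceSphereMeasure Hᗮ := by
  obtain ⟨dA, hdA⟩ : ∃ dA, m = k + dA := ⟨m - k, by omega⟩
  obtain ⟨dB, hdB⟩ : ∃ dB, n - m = k + dB := ⟨n - m - k, by omega⟩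
  have hH' : Module.finrank ℝ Hᗮ = k + dB := by
    have := H.finrank_add_finrank_orthogonal
    rw [finrank_euclideanSpace_fin] at this
    omega
  set T := compression k H.starProjection with hT
  have hD' : ∀ z, ‖(2 : ℝ) • compression k Hᗮ.starProjection z - z‖ ≤ τ * ‖z‖ := by
    intro z
    convert! hD z using 1
    rw [compression_orthogonal (by omega), ← norm_neg]; congr 1; module
  obtain ⟨M, hM, hgM⟩ := exists_density_subspace H (d := dA) (by omega) (by omega) (by linarith) hD
  obtain ⟨N, hN, hgN⟩ := exists_density_subspace Hᗮ (d := dB) (by omega) hH' (by linarith) hD'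
  have hN' : ∀ z, N ((N : E k →L[ℝ] E k).adjoint z) = z - T z := fun z =>
    (hN z).trans (compression_orthogonal (by omega) H z)
  have hS : MeasurableSet {z : E k | ‖z‖ ^ 2 ≤ s₀} := measurableSet_le (by fun_prop) (by fun_prop)
  have hmM : Measurable fun z : E k => projWeight dA (M.symm z) :=
    measurable_projWeight.comp M.symm.continuous.measurable
  have hmN : Measurable fun z : E k => projWeight dB (N.symm z) :=
    measurable_projWeight.comp N.symm.continuous.measurable
  have hL : ∫⁻ x, {z | ‖z‖ ^ 2 ≤ s₀}.indicator g (coordProj n k (x : E n)) ∂sphereMeasure (E n) =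
      ∫⁻ z in {z : E k | ‖z‖ ^ 2 ≤ s₀},
        g z * (ENNReal.ofReal (projConst k d) * projWeight d z) := by
    rw [lintegral_coordProj (by omega) hn (hg.indicator hS), ← lintegral_const_mul _
      (by fun_prop (disch := exact hS)), ← lintegral_indicator hS]
    refine lintegral_congr fun z => ?_
    by_cases hz : z ∈ {z : E k | ‖z‖ ^ 2 ≤ s₀}
    · rw [Set.indicator_of_mem hz, Set.indicator_of_mem hz]; ring
    · rw [Set.indicator_of_notMem hz, Set.indicator_of_notMem hz]; simp
  rw [hL, hgM g hg, hgN g hg]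
  refine mul_sq_setLIntegral_le (by fun_prop) (by fun_prop) (by fun_prop) fun z hz => ?_
  have hz : ‖z‖ ^ 2 ≤ s₀ := hz
  -- The inequality of the densities, in real numbers.
  set a := ‖M.symm z‖ ^ 2 with ha
  set b := ‖N.symm z‖ ^ 2 with hb
  set s := ‖z‖ ^ 2 with hs
  have hs_nn : 0 ≤ s := by positivity
  have ha4 : a ≤ 4 * s := norm_symm_sq_le hM hτ hD z
  have hb4 : b ≤ 4 * s := norm_symm_sq_le hN hτ hD' z
  have hab : a + b ≤ 4 * (1 + 4 / 3 * τ ^ 2) * s := norm_symm_sq_add_le hM hN' hτ0 hτ hD z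
  have hnR : (n : ℝ) = k + d := by rw [hn]; push_cast; ring
  have hmR : (m : ℝ) = k + dA := by rw [hdA]; push_cast; ring
  have hm2 : (2 : ℝ) * m ≤ n := by exact_mod_cast (by omega : 2 * m ≤ n)
  have hm2' : (n : ℝ) ≤ 2 * m + 1 := by exact_mod_cast (by omega : n ≤ 2 * m + 1)
  have hnmR : (n : ℝ) - m = k + dB := by
    have : (n : ℝ) = m + (k + dB) := by exact_mod_cast (by omega : n = m + (k + dB))
    linarith
  have hdA3 : (3 : ℝ) ≤ dA := by exact_mod_cast (by omega : 3 ≤ dA)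
  have hdB3 : (3 : ℝ) ≤ dB := by exact_mod_cast (by omega : 3 ≤ dB)
  have hd3 : (3 : ℝ) ≤ d := by exact_mod_cast (by omega : 3 ≤ d)
  have hk0 : (0 : ℝ) ≤ k := k.cast_nonneg
  have hweight := rpow_mul_rpow_ge (n := n) (k := k) (pA := ((dA : ℝ) - 2) / 2)
    (pB := ((dB : ℝ) - 2) / 2) (p := ((d : ℝ) - 2) / 2) (by positivity : 0 ≤ a)
    (by positivity : 0 ≤ b) hs_nn ha4 hb4 (hz.trans hs0) hab (by linarith) (by linarith)
    (by linarith) (by linarith) (by linarith) (by linarith)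
  have hconst := projConst_mul_ge (k := k) (d := d) (dA := dA) (dB := dB) (by omega) (by omega)
    (by omega) hq (by rw [← hn]; linarith) (by rw [← hn]; linarith)
  have hdet := abs_det_mul_abs_det_le hM hN' fun z => (hD z).trans
    (by nlinarith [norm_nonneg z])
  have hdetM : 0 < |(M : E k →L[ℝ] E k).det| :=
    abs_pos.mpr (LinearEquiv.isUnit_det' M.toLinearEquiv).ne_zero
  have hdetN : 0 < |(N : E k →L[ℝ] E k).det| :=
    abs_pos.mpr (LinearEquiv.isUnit_det' N.toLinearEquiv).ne_zero
  set δM := |(M : E k →L[ℝ] E k).det|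
  set δN := |(N : E k →L[ℝ] E k).det|
  set c := projConst k d
  set cA := projConst k dA
  set cB := projConst k dB
  have hc0 : 0 < c := projConst_pos k (by omega)
  have hcA0 : 0 < cA := projConst_pos k (by omega)
  have hcB0 : 0 < cB := projConst_pos k (by omega)
  have hδ : (2 : ℝ) ^ k ≤ δM⁻¹ * δN⁻¹ := by
    have h1 : (δM * δN) ^ 2 ≤ ((1 / 2) ^ k) ^ 2 := by
      rw [← pow_mul, mul_comm k, pow_mul]; norm_num at hdet ⊢; exact hdet
    have h2 := (sq_le_sq₀ (by positivity) (by positivity)).mp h1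
    rw [← mul_inv, le_inv_comm₀ (by positivity) (by positivity)]
    simpa using h2
  have hηmono : Real.exp (-(n * (4 / 3 * τ ^ 2 * s₀ + 16 * s₀ ^ 2) + (k + 2) * s₀)) ≤
      Real.exp (-(n * (4 / 3 * τ ^ 2 * s + 16 * s ^ 2) + (k + 2) * s)) := by
    gcongr
  have hreal : κ * (c * (1 - s) ^ (((d : ℝ) - 2) / 2)) ^ 2 ≤
      (cA * δM⁻¹ * (1 - a) ^ (((dA : ℝ) - 2) / 2)) *
        (cB * δN⁻¹ * (1 - b) ^ (((dB : ℝ) - 2) / 2)) := by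
    exact mul_density_sq_le hκ0 hκ (Real.exp_pos _) hηmono hcA0.le hcB0.le hconst hδ
      hweight
  have h1 : 0 ≤ (1 - a) ^ (((dA : ℝ) - 2) / 2) := Real.rpow_nonneg (by linarith) _
  have h2 : 0 ≤ (1 - s) ^ (((d : ℝ) - 2) / 2) := Real.rpow_nonneg (by linarith) _
  rw [projWeight_eq_ofReal (d := d) (by linarith : ‖z‖ ^ 2 < 1),
    projWeight_eq_ofReal (d := dA) (by linarith : ‖M.symm z‖ ^ 2 < 1),
    projWeight_eq_ofReal (d := dB) (by linarith : ‖N.symm z‖ ^ 2 < 1),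
    ← ENNReal.ofReal_mul (by positivity), ← ENNReal.ofReal_mul (by positivity),
    ← ENNReal.ofReal_mul (by positivity)]
  calc ENNReal.ofReal κ * (g z * ENNReal.ofReal (c * (1 - s) ^ (((d : ℝ) - 2) / 2))) ^ 2
      = ENNReal.ofReal (κ * (c * (1 - s) ^ (((d : ℝ) - 2) / 2)) ^ 2) * g z ^ 2 := by
        rw [ENNReal.ofReal_mul hκ0, ENNReal.ofReal_pow (by positivity)]; ring
    _ ≤ ENNReal.ofReal ((cA * δM⁻¹ * (1 - a) ^ (((dA : ℝ) - 2) / 2)) *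
        (cB * δN⁻¹ * (1 - b) ^ (((dB : ℝ) - 2) / 2))) * g z ^ 2 := by gcongr
    _ = _ := by
        rw [ENNReal.ofReal_mul (by positivity)]; ring

/-! ### Concentration of projections, and the Haar measure of the orthogonal group -/

/-- Chernoff's bound for the norm of a projection of a uniform point of the sphere, from the
exponential moment of the Gaussian quadratic form `‖W x‖² - δ ‖x‖²`. -/
theorem sphereMeasure_le_norm_sq_le {V : Type*} [NormedAddCommGroup V] [InnerProductSpace ℝ V]
    [FiniteDimensional ℝ V] [MeasurableSpace V] [BorelSpace V] [Nontrivial V]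
    {j d : ℕ} (hV : Module.finrank ℝ V = j + d) (W : V →L[ℝ] E j)
    (hW : ∀ z, W (W.adjoint z) = z) {δ μ : ℝ} (hμ : 0 ≤ μ) (h1 : μ * (1 - δ) < 1)
    (h2 : 0 < 1 + μ * δ) :
    sphereMeasure V {θ | δ ≤ ‖W (θ : V)‖ ^ 2} ≤
      ENNReal.ofReal ((1 / (1 - μ * (1 - δ))) ^ ((j : ℝ) / 2) *
        (1 / (1 + μ * δ)) ^ ((d : ℝ) / 2)) := by
  have ha : 0 < 1 - μ * (1 - δ) := by linarith
  set S : Set V := {x | δ * ‖x‖ ^ 2 ≤ ‖W x‖ ^ 2} with hS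
  have hSm : MeasurableSet S := measurableSet_le (by fun_prop) (by fun_prop)
  have e1 : sphereMeasure V {θ | δ ≤ ‖W (θ : V)‖ ^ 2} =
      ∫⁻ θ, S.indicator 1 (θ : V) ∂sphereMeasure V := by
    rw [← lintegral_indicator_one (measurableSet_le (by fun_prop) (by fun_prop))]
    refine lintegral_congr fun θ => ?_
    have : ‖(θ : V)‖ = 1 := mem_sphere_zero_iff_norm.mp θ.2
    simp [Set.indicator, hS, this]
  rw [e1, lintegral_sphereMeasure_eq_gaussian (measurable_one.indicator hSm)]
  calc ∫⁻ x : V, S.indicator 1 (‖x‖⁻¹ • x) * ENNReal.ofReal (Real.exp (-Real.pi * ‖x‖ ^ 2))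
      ≤ ∫⁻ x : V, (fun (y : E j) (R : ℝ) => ENNReal.ofReal
          (Real.exp (Real.pi * μ * (‖y‖ ^ 2 - δ * R ^ 2) - Real.pi * R ^ 2))) (W x) ‖x‖ := by
        refine lintegral_mono fun x => ?_
        by_cases hx : ‖x‖⁻¹ • x ∈ S
        · rw [Set.indicator_of_mem hx, Pi.one_apply, one_mul]
          refine ENNReal.ofReal_le_ofReal (Real.exp_le_exp.mpr ?_)
          have h3 : δ * ‖x‖ ^ 2 ≤ ‖W x‖ ^ 2 := by
            rcases eq_or_ne x 0 with rfl | hx0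
            · simp
            have hn : 0 < ‖x‖ := norm_pos_iff.mpr hx0
            have hx' : δ * ‖‖x‖⁻¹ • x‖ ^ 2 ≤ ‖W (‖x‖⁻¹ • x)‖ ^ 2 := hx
            rw [map_smul, norm_smul, norm_smul, norm_inv, norm_norm, inv_mul_cancel₀ hn.ne',
              mul_pow, inv_pow, one_pow, mul_one] at hx'
            rwa [inv_mul_eq_div, le_div_iff₀ (by positivity)] at hx'
          nlinarith [mul_nonneg (mul_nonneg Real.pi_pos.le hμ) (sub_nonneg.mpr h3)]
        · rw [Set.indicator_of_notMem hx, zero_mul]; exact zero_le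
    _ = ∫⁻ y : E j, ∫⁻ w : E d,
          ENNReal.ofReal (Real.exp (-(Real.pi * (1 - μ * (1 - δ))) * ‖y‖ ^ 2)) *
          ENNReal.ofReal (Real.exp (-(Real.pi * (1 + μ * δ)) * ‖w‖ ^ 2)) := by
        rw [lintegral_split_of_coisometry hV W hW (F := fun (y : E j) (R : ℝ) => ENNReal.ofReal
          (Real.exp (Real.pi * μ * (‖y‖ ^ 2 - δ * R ^ 2) - Real.pi * R ^ 2)))
          (by unfold Function.uncurry; fun_prop)]
        refine lintegral_congr fun y => lintegral_congr fun w => ?_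
        rw [← ENNReal.ofReal_mul (Real.exp_pos _).le, ← Real.exp_add,
          Real.sq_sqrt (by positivity)]
        congr 2; ring
    _ = _ := by
        rw [lintegral_lintegral_mul (by fun_prop) (by fun_prop),
          lintegral_exp_neg_mul_sq_norm _ (by positivity),
          lintegral_exp_neg_mul_sq_norm _ (by positivity), finrank_euclideanSpace_fin,
          finrank_euclideanSpace_fin, ← ENNReal.ofReal_mul (by positivity)]
        congr 3 <;> field_simp

theorem lintegral_sphereMeasure_comp_isometry {V : Type*} [NormedAddCommGroup V]
    [InnerProductSpace ℝ V] [FiniteDimensional ℝ V] [MeasurableSpace V] [BorelSpace V]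
    [Nontrivial V] (u : V ≃ₗᵢ[ℝ] V) {g : V → ℝ≥0∞} (hg : Measurable g) :
    ∫⁻ θ, g (u (θ : V)) ∂sphereMeasure V = ∫⁻ θ, g (θ : V) ∂sphereMeasure V := by
  have hu : Measurable u := u.continuous.measurable
  rw [lintegral_sphereMeasure_eq_gaussian (g := fun x => g (u x)) (hg.comp hu),
    lintegral_sphereMeasure_eq_gaussian hg,
    ← u.measurePreserving.lintegral_comp (f := fun x =>
      g (‖x‖⁻¹ • x) * ENNReal.ofReal (Real.exp (-Real.pi * ‖x‖ ^ 2))) (by fun_prop)]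
  refine lintegral_congr fun x => ?_
  rw [u.norm_map, map_smul]

/-- Two unit vectors are exchanged by a reflection. -/
theorem exists_star_apply_eq {n : ℕ} {e e' : E n} (h : ‖e‖ = ‖e'‖) :
    ∃ V : OrthGroup n, star (V : E n →L[ℝ] E n) e = e' := by
  refine ⟨star (Unitary.linearIsometryEquiv.symm
    (Submodule.reflection (Submodule.span ℝ {e - e'})ᗮ)), ?_⟩
  rw [Unitary.coe_star, star_star]
  exact Submodule.reflection_sub h

/-- The topology of the operator norm is second countable, so that the Borel sets of products with
the orthogonal group are product measurable. -/
instance secondCountable_endomorphisms (n : ℕ) : SecondCountableTopology (E n →L[ℝ] E n) :=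
  have : ProperSpace (E n →L[ℝ] E n) := FiniteDimensional.proper ℝ _
  secondCountable_of_proper

/-- For a Haar distributed orthogonal `U` and a unit vector `e`, the vector `U* e` is uniformly
distributed on the sphere: its law does not depend on `e`, so `e` may be averaged over the
sphere. -/
theorem lintegral_haarOrth_star_apply {n : ℕ} {e : E n} (he : ‖e‖ = 1) {F : E n → ℝ≥0∞}
    (hF : Measurable F) :
    ∫⁻ U : OrthGroup n, F (star (U : E n →L[ℝ] E n) e) ∂haarOrth n =
      ∫⁻ θ, F (θ : E n) ∂sphereMeasure (E n) := by
  have : Nontrivial (E n) := ⟨e, 0, by rintro rfl; simp at he⟩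
  have := isProbabilityMeasure_haarOrth n
  have := isProbabilityMeasure_sphereMeasure (E n)
  have hcont : Continuous fun p : OrthGroup n × E n => star (p.1 : E n →L[ℝ] E n) p.2 :=
    Continuous.clm_apply (by fun_prop) continuous_snd
  have hmeas : Measurable fun p : OrthGroup n × E n => F (star (p.1 : E n →L[ℝ] E n) p.2) :=
    hF.comp hcont.measurable
  have hme : Measurable fun U : OrthGroup n => F (star (U : E n →L[ℝ] E n) e) :=
    hF.comp (Continuous.clm_apply (by fun_prop) continuous_const).measurable
  have hconst : ∀ θ : sphere (0 : E n) 1,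
      ∫⁻ U : OrthGroup n, F (star (U : E n →L[ℝ] E n) θ) ∂haarOrth n =
        ∫⁻ U : OrthGroup n, F (star (U : E n →L[ℝ] E n) e) ∂haarOrth n := by
    intro θ
    obtain ⟨V, hV⟩ := exists_star_apply_eq (e := e) (e' := θ)
      (he.trans (mem_sphere_zero_iff_norm.mp θ.2).symm)
    have hleft : (haarOrth n).map (fun U => V * U) = haarOrth n := by
      unfold haarOrth
      exact map_mul_left_eq_self _ V
    conv_rhs => rw [← hleft]
    rw [lintegral_map (f := fun U : OrthGroup n => F (star (U : E n →L[ℝ] E n) e))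
      hme (measurable_const_mul V)]
    refine lintegral_congr fun U => ?_
    rw [← hV, ← mul_apply_eq_comp, ← star_mul]
    rfl
  have h1 : ∫⁻ θ : sphere (0 : E n) 1, ∫⁻ U : OrthGroup n, F (star (U : E n →L[ℝ] E n) θ)
      ∂haarOrth n ∂sphereMeasure (E n) =
      ∫⁻ U : OrthGroup n, F (star (U : E n →L[ℝ] E n) e) ∂haarOrth n := by
    rw [lintegral_congr hconst, lintegral_const, measure_univ, mul_one]
  rw [← h1, lintegral_lintegral_swap]
  · have h2 : ∀ U : OrthGroup n, ∫⁻ θ : sphere (0 : E n) 1, F (star (U : E n →L[ℝ] E n) θ)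
        ∂sphereMeasure (E n) = ∫⁻ θ, F (θ : E n) ∂sphereMeasure (E n) := fun U =>
      lintegral_sphereMeasure_comp_isometry (Unitary.linearIsometryEquiv (star U)) hF
    rw [lintegral_congr h2, lintegral_const, measure_univ, mul_one]
  · have h3 : Measurable fun p : sphere (0 : E n) 1 × OrthGroup n => (p.2, (p.1 : E n)) := by
      fun_prop
    exact (hmeas.comp h3).aemeasurable

theorem exists_coisometry_of_subspace {n m : ℕ} (H : Submodule ℝ (E n))
    (hH : Module.finrank ℝ H = m) :
    ∃ W : E n →L[ℝ] E m, (∀ z, W (W.adjoint z) = z) ∧ ∀ x, ‖W x‖ = ‖H.starProjection x‖ := by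
  let b : H ≃ₗᵢ[ℝ] E m := ((stdOrthonormalBasis ℝ H).reindex (finCongr hH)).repr
  refine ⟨(b : H →L[ℝ] E m) ∘L H.orthogonalProjectionOnto, fun z => ?_, fun x => ?_⟩
  · rw [ContinuousLinearMap.adjoint_comp, Submodule.adjoint_orthogonalProjectionOnto]
    refine ext_inner_right ℝ fun w => ?_
    simp only [ContinuousLinearMap.comp_apply]
    rw [Submodule.subtypeL_apply, Submodule.orthogonalProjectionOnto_mem_subspace_eq_self]
    have h := ContinuousLinearMap.adjoint_inner_left (b : H →L[ℝ] E m) (b.symm w) z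
    have h2 : (b : H →L[ℝ] E m) (b.symm w) = w := b.apply_symm_apply w
    rw [h2] at h
    rw [← h, ← b.inner_map_map _ (b.symm w), b.apply_symm_apply]
    rfl
  · exact b.norm_map _

/-- The product of the two Chernoff factors for the deviation `t`, with the multiplier `2 t`. The
bases multiply to `1 + t² + t⁴`; the factor `2` allows the exponents to differ. -/
theorem chernoff_factor_le {t x y : ℝ} (ht0 : 0 ≤ t) (ht : t ≤ 1 / 2) (hx : 0 ≤ x)
    (hxy : x ≤ y + 1) {m : ℝ} (hmx : m ≤ x) :
    (1 / (1 - 2 * t * (1 - (1 + t) / 2))) ^ (x / 2) * (1 / (1 + 2 * t * ((1 + t) / 2))) ^ (y / 2) ≤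
      2 * Real.exp (-(t ^ 2 * m / 4)) := by
  have ha : 0 < 1 - 2 * t * (1 - (1 + t) / 2) := by nlinarith
  have hb : 0 < 1 + 2 * t * ((1 + t) / 2) := by positivity
  have hab : t ^ 2 / 2 ≤ Real.log (1 - 2 * t * (1 - (1 + t) / 2)) +
      Real.log (1 + 2 * t * ((1 + t) / 2)) := by
    rw [← Real.log_mul ha.ne' hb.ne']
    have e : (1 - 2 * t * (1 - (1 + t) / 2)) * (1 + 2 * t * ((1 + t) / 2)) = 1 + t ^ 2 + t ^ 4 := by
      ring
    rw [e]
    refine le_trans ?_ (Real.one_sub_inv_le_log_of_pos (by positivity))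
    have h : (1 + t ^ 2 + t ^ 4)⁻¹ ≤ 1 - t ^ 2 / 2 := by
      have : t ^ 2 ≤ 1 / 4 := by nlinarith
      rw [inv_le_iff_one_le_mul₀ (by positivity)]
      nlinarith [sq_nonneg t, sq_nonneg (t ^ 2), mul_nonneg (sq_nonneg t) (sub_nonneg.mpr this),
        mul_nonneg (sq_nonneg (t ^ 2)) (sub_nonneg.mpr this)]
    linarith
  have hlb : Real.log (1 + 2 * t * ((1 + t) / 2)) ≤ 3 / 4 := by
    have := Real.log_le_sub_one_of_pos hb
    nlinarith
  have hlb0 : 0 ≤ Real.log (1 + 2 * t * ((1 + t) / 2)) := Real.log_nonneg (by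
    have : 0 ≤ 2 * t * ((1 + t) / 2) := by positivity
    linarith)
  rw [Real.rpow_def_of_pos (by positivity), Real.rpow_def_of_pos (by positivity), one_div, one_div,
    Real.log_inv, Real.log_inv, ← Real.exp_add]
  have h2 : (2 : ℝ) = Real.exp (Real.log 2) := (Real.exp_log two_pos).symm
  rw [show 2 * Real.exp (-(t ^ 2 * m / 4)) = Real.exp (Real.log 2 + -(t ^ 2 * m / 4)) by
    rw [Real.exp_add, ← h2], Real.exp_le_exp]
  have := Real.log_two_gt_d9
  nlinarith [mul_le_mul_of_nonneg_right hxy hlb0, mul_le_mul_of_nonneg_right hab hx,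
    mul_le_mul_of_nonneg_right hmx (sq_nonneg t)]

/-- For a uniform `θ` in the sphere, `‖Π θ‖²` is near `1/2` if `Π` is the projection to a subspace
of dimension `⌊n / 2⌋`. -/
theorem sphereMeasure_starProjection_le {n m : ℕ} (hm : m = n / 2) (hn : 1 ≤ n)
    (H : Submodule ℝ (E n))
    (hH : Module.finrank ℝ H = m) {t : ℝ} (ht0 : 0 ≤ t) (ht : t ≤ 1 / 2) :
    sphereMeasure (E n) {θ | t < |2 * ‖H.starProjection (θ : E n)‖ ^ 2 - 1|} ≤
      ENNReal.ofReal (4 * Real.exp (-(t ^ 2 * m / 4))) := by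
  have : Nontrivial (E n) := Module.nontrivial_of_finrank_pos (R := ℝ) (by
    rw [finrank_euclideanSpace_fin]; omega)
  have hH' : Module.finrank ℝ Hᗮ = n - m := by
    have := H.finrank_add_finrank_orthogonal
    rw [finrank_euclideanSpace_fin] at this
    omega
  obtain ⟨W, hW, hWn⟩ := exists_coisometry_of_subspace H hH
  obtain ⟨W', hW', hWn'⟩ := exists_coisometry_of_subspace Hᗮ hH'
  have h1 : 2 * t * (1 - (1 + t) / 2) < 1 := by nlinarith
  have h2 : 0 < 1 + 2 * t * ((1 + t) / 2) := by positivity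
  have hA := sphereMeasure_le_norm_sq_le (V := E n) (j := m) (d := n - m)
    (by rw [finrank_euclideanSpace_fin]; omega) W hW (by positivity : 0 ≤ 2 * t) h1 h2
  have hB := sphereMeasure_le_norm_sq_le (V := E n) (j := n - m) (d := m)
    (by rw [finrank_euclideanSpace_fin]; omega) W' hW' (by positivity : 0 ≤ 2 * t) h1 h2
  have hsub : {θ : sphere (0 : E n) 1 | t < |2 * ‖H.starProjection (θ : E n)‖ ^ 2 - 1|} ⊆
      {θ | (1 + t) / 2 ≤ ‖W (θ : E n)‖ ^ 2} ∪ {θ | (1 + t) / 2 ≤ ‖W' (θ : E n)‖ ^ 2} := by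
    intro θ hθ
    have hθ : t < |2 * ‖H.starProjection (θ : E n)‖ ^ 2 - 1| := hθ
    have h3 : ‖(θ : E n)‖ ^ 2 = ‖W θ‖ ^ 2 + ‖W' θ‖ ^ 2 := by
      rw [hWn, hWn']; exact Submodule.norm_sq_eq_add_norm_sq_starProjection (θ : E n) H
    rw [mem_sphere_zero_iff_norm.mp θ.2] at h3
    rw [← hWn, lt_abs] at hθ
    simp only [Set.mem_union, Set.mem_ofPred_eq]
    rcases hθ with hθ | hθ
    · left; linarith
    · right; linarith
  have hcast : ((n - m : ℕ) : ℝ) = n - m := Nat.cast_sub (by omega)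
  have hm2 : (2 : ℝ) * m ≤ n := by exact_mod_cast (by omega : 2 * m ≤ n)
  have hm2' : (n : ℝ) ≤ 2 * m + 1 := by exact_mod_cast (by omega : n ≤ 2 * m + 1)
  have hA' := chernoff_factor_le ht0 ht (x := m) (y := (n - m : ℕ)) (by positivity)
    (by rw [hcast]; linarith) le_rfl
  have hB' := chernoff_factor_le ht0 ht (y := m) (x := (n - m : ℕ)) (by positivity)
    (by rw [hcast]; linarith) (m := m) (by rw [hcast]; linarith)
  calc _ ≤ _ := measure_mono hsub
    _ ≤ _ := measure_union_le _ _
    _ ≤ _ := add_le_add (hA.trans (ENNReal.ofReal_le_ofReal hA'))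
        (hB.trans (ENNReal.ofReal_le_ofReal hB'))
    _ = _ := by
      rw [← ENNReal.ofReal_add (by positivity) (by positivity)]; congr 1; ring

/-! ### The norm of the deviation of a random subspace -/

/-- A symmetric operator with large norm has a large quadratic form on a whole ball around an
approximate maximizer of its Rayleigh quotient. -/
theorem exists_ball_inner_gt {k : ℕ} {D : E k →L[ℝ] E k} (hD : D.IsSymmetric) {τ : ℝ}
    (hτ : 0 ≤ τ) (h : τ < ‖D‖) :
    ∃ v : E k, ‖v‖ = 1 ∧ ∀ θ ∈ ball v (1 / 8), τ / 2 * ‖θ‖ ^ 2 < |⟪D θ, θ⟫_ℝ| := by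
  have hN : 0 < ‖D‖ := hτ.trans_lt h
  -- The loss `(1 / 8) (17 / 8) ‖D‖` on the ball leaves more than `‖D‖ / 2 * (9 / 8)²` of this.
  have h1 : 49 / 50 * ‖D‖ < ⨆ x, |D.rayleighQuotient x| := by
    rw [← D.norm_eq_iSup_rayleighQuotient hD]; linarith
  obtain ⟨x, hx⟩ := exists_lt_of_lt_ciSup h1
  have hx0 : x ≠ 0 := by
    rintro rfl
    rw [ContinuousLinearMap.rayleighQuotient_apply_zero, abs_zero] at hx
    linarith
  have hxn : 0 < ‖x‖ := norm_pos_iff.mpr hx0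
  set v : E k := ‖x‖⁻¹ • x with hv
  have hv1 : ‖v‖ = 1 := by
    rw [hv, norm_smul, norm_inv, norm_norm, inv_mul_cancel₀ hxn.ne']
  have hv2 : 49 / 50 * ‖D‖ < |⟪D v, v⟫_ℝ| := by
    rw [← D.rayleigh_smul x (c := ‖x‖⁻¹) (inv_ne_zero hxn.ne')] at hx
    change _ < |⟪D v, v⟫_ℝ / ‖v‖ ^ 2| at hx
    rwa [hv1, one_pow, div_one] at hx
  refine ⟨v, hv1, fun θ hθ => ?_⟩
  rw [mem_ball_iff_norm] at hθ
  have hθn : ‖θ‖ ≤ 9 / 8 := by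
    have := norm_add_le (θ - v) v
    rw [sub_add_cancel, hv1] at this
    linarith
  have h2 : ⟪D θ, θ⟫_ℝ - ⟪D v, v⟫_ℝ = ⟪D (θ - v), θ + v⟫_ℝ := by
    have h3 : ⟪D v, θ⟫_ℝ = ⟪D θ, v⟫_ℝ := (hD v θ).trans (real_inner_comm _ _)
    rw [map_sub, inner_sub_left, inner_add_right, inner_add_right, h3]
    ring
  have h4 : |⟪D (θ - v), θ + v⟫_ℝ| ≤ ‖D‖ * (1 / 8) * (17 / 8) := by
    refine (abs_real_inner_le_norm _ _).trans ?_
    refine mul_le_mul ((D.le_opNorm _).trans (by gcongr)) ?_ (norm_nonneg _) (by positivity)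
    refine (norm_add_le _ _).trans ?_
    rw [hv1]; linarith
  have h5 : |⟪D v, v⟫_ℝ| - |⟪D θ, θ⟫_ℝ| ≤ ‖D‖ * (1 / 8) * (17 / 8) := by
    refine (abs_sub_abs_le_abs_sub _ _).trans ?_
    rw [abs_sub_comm, h2]; exact h4
  have h6 : ‖θ‖ ^ 2 ≤ 81 / 64 := by nlinarith [norm_nonneg θ]
  have h7 : τ / 2 * ‖θ‖ ^ 2 ≤ ‖D‖ / 2 * (81 / 64) := by gcongr
  linarith

/-- If each value of the quadratic form of a random symmetric operator on `ℝᵏ` is small with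
probability at least `1 - p`, then its norm is small with probability at least `1 - 9ᵏ p`.
The event that the norm is large is tested on a random point of a ball, in place of a net. -/
theorem measure_lt_norm_le {Ω : Type*} [TopologicalSpace Ω] [MeasurableSpace Ω] [BorelSpace Ω]
    [SecondCountableTopology Ω] (P : Measure Ω) [IsProbabilityMeasure P] {k : ℕ}
    {D : Ω → E k →L[ℝ] E k} (hDc : Continuous D) (hD : ∀ ω, (D ω).IsSymmetric) {τ : ℝ}
    (hτ : 0 ≤ τ) {p : ℝ≥0∞}
    (hp : ∀ θ : E k, P {ω | τ / 2 * ‖θ‖ ^ 2 < |⟪D ω θ, θ⟫_ℝ|} ≤ p) :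
    P {ω | τ < ‖D ω‖} ≤ 9 ^ k * p := by
  set ν : Measure (E k) := volume.restrict (ball 0 (9 / 8)) with hν
  set A : Set (Ω × E k) := {q | τ / 2 * ‖q.2‖ ^ 2 < |⟪D q.1 q.2, q.2⟫_ℝ|} with hA
  have hDq : Continuous fun q : Ω × E k => D q.1 q.2 :=
    Continuous.clm_apply (hDc.comp continuous_fst) continuous_snd
  have hAm : MeasurableSet A :=
    (isOpen_lt (by fun_prop) (hDq.inner continuous_snd).abs).measurableSet
  have hBm : MeasurableSet {ω | τ < ‖D ω‖} :=
    (isOpen_lt continuous_const hDc.norm).measurableSet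
  have hr : (volume : Measure (E k)) (ball 0 (9 / 8)) =
      9 ^ k * (volume : Measure (E k)) (ball 0 (1 / 8)) := by
    have := Measure.addHaar_ball_mul_of_pos (volume : Measure (E k)) 0 (r := 9) (by norm_num)
      (1 / 8)
    rw [finrank_euclideanSpace_fin] at this
    norm_num at this ⊢
    exact this
  have hlow : P {ω | τ < ‖D ω‖} * (volume : Measure (E k)) (ball 0 (1 / 8)) ≤ P.prod ν A := by
    rw [Measure.prod_apply hAm, mul_comm, ← setLIntegral_const]
    refine (setLIntegral_mono (measurable_measure_prodMk_left hAm) fun ω hω => ?_).trans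
      (setLIntegral_le_lintegral _ _)
    obtain ⟨v, hv, hball⟩ := exists_ball_inner_gt (hD ω) hτ hω
    rw [hν, Measure.restrict_apply (measurable_prodMk_left hAm),
      ← Measure.addHaar_ball_center volume v]
    refine measure_mono fun θ hθ => ⟨hball θ hθ, ?_⟩
    rw [mem_ball_zero_iff]
    rw [mem_ball_iff_norm] at hθ
    have := norm_add_le (θ - v) v
    rw [sub_add_cancel, hv] at this
    linarith
  have hup : P.prod ν A ≤ p * (volume : Measure (E k)) (ball 0 (9 / 8)) := by
    rw [Measure.prod_apply_symm hAm]
    refine (lintegral_mono fun θ => hp θ).trans ?_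
    rw [lintegral_const, hν, Measure.restrict_apply_univ]
  have h := hlow.trans hup
  rw [hr, mul_left_comm, ← mul_assoc] at h
  exact (ENNReal.mul_le_mul_iff_left (measure_ball_pos _ _ (by norm_num)).ne'
    measure_ball_lt_top.ne).mp h

theorem starProjection_rotate {n m : ℕ} (U : OrthGroup n) (H : Gr n m) :
    (rotate U H).1.starProjection = (U : E n →L[ℝ] E n) * H.1.starProjection *
      star (U : E n →L[ℝ] E n) := by
  ext1 x
  exact Submodule.starProjection_map_apply (Unitary.linearIsometryEquiv U) H.1 x

/-- Twice the deviation from `1/2` of the compression to `ℝᵏ` of the projection to `H`. -/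
noncomputable def deviation {n : ℕ} (k : ℕ) (H : Submodule ℝ (E n)) : E k →L[ℝ] E k :=
  (2 : ℝ) • compression k H.starProjection - ContinuousLinearMap.id ℝ (E k)

theorem inner_compression {n k : ℕ} (A : E n →L[ℝ] E n) (z w : E k) :
    ⟪compression k A z, w⟫_ℝ = ⟪A (coordEmb n k z), coordEmb n k w⟫_ℝ := by
  rw [compression_apply, coordProj, ContinuousLinearMap.adjoint_inner_left]

theorem isSymmetric_deviation {n k : ℕ} (H : Submodule ℝ (E n)) :
    (deviation k H).IsSymmetric := by
  intro z w
  have h := Submodule.starProjection_isSymmetric (K := H) (coordEmb n k z) (coordEmb n k w)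
  change ⟪H.starProjection _, _⟫_ℝ = ⟪_, H.starProjection _⟫_ℝ at h
  change ⟪(2 : ℝ) • compression k H.starProjection z - z, w⟫_ℝ =
    ⟪z, (2 : ℝ) • compression k H.starProjection w - w⟫_ℝ
  rw [inner_sub_left, inner_sub_right, inner_smul_left, inner_smul_right, inner_compression, h,
    real_inner_comm (compression k H.starProjection w), inner_compression,
    real_inner_comm (coordEmb n k z)]
  simp

theorem inner_deviation {n k : ℕ} (H : Submodule ℝ (E n)) (z : E k) :
    ⟪deviation k H z, z⟫_ℝ = 2 * ‖H.starProjection (coordEmb n k z)‖ ^ 2 - ‖z‖ ^ 2 := by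
  change ⟪(2 : ℝ) • compression k H.starProjection z - z, z⟫_ℝ = _
  have h := Submodule.starProjection_isSymmetric (K := H) (coordEmb n k z)
    (H.starProjection (coordEmb n k z))
  change ⟪H.starProjection _, H.starProjection _⟫_ℝ =
    ⟪_, H.starProjection (H.starProjection _)⟫_ℝ at h
  rw [Submodule.starProjection_eq_self_iff.mpr (Submodule.starProjection_apply_mem H _),
    real_inner_self_eq_norm_sq] at h
  rw [inner_sub_left, inner_smul_left, inner_compression, real_inner_comm, h,
    real_inner_self_eq_norm_sq, conj_trivial]

/-- For a random subspace of dimension `⌊n / 2⌋`, the compressed projection is near `1/2`. -/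
theorem haarOrth_deviation_le {n k m : ℕ} (hm : m = n / 2) (hn : 1 ≤ n) (hk : k ≤ n) (H : Gr n m)
    {t : ℝ} (ht0 : 0 ≤ t) (ht : t ≤ 1 / 2) :
    haarOrth n {U | 2 * t < ‖deviation k (rotate U H).1‖} ≤
      9 ^ k * ENNReal.ofReal (4 * Real.exp (-(t ^ 2 * m / 4))) := by
  have := isProbabilityMeasure_haarOrth n
  have hcont : Continuous fun U : OrthGroup n => deviation k (rotate U H).1 := by
    unfold deviation compression
    simp_rw [starProjection_rotate]
    fun_prop
  refine measure_lt_norm_le (haarOrth n) hcont (fun U => isSymmetric_deviation _) (by positivity)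
    fun θ => ?_
  rcases eq_or_ne θ 0 with rfl | hθ
  · simp
  have hθn : 0 < ‖θ‖ := norm_pos_iff.mpr hθ
  set e : E n := coordEmb n k (‖θ‖⁻¹ • θ) with he
  have hen : ‖e‖ = 1 := by
    rw [he, norm_coordEmb hk, norm_smul, norm_inv, norm_norm, inv_mul_cancel₀ hθn.ne']
  have hθe : coordEmb n k θ = ‖θ‖ • e := by
    rw [he, map_smul, smul_smul, mul_inv_cancel₀ hθn.ne', one_smul]
  set S : Set (E n) := {x | t < |2 * ‖H.1.starProjection x‖ ^ 2 - 1|} with hS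
  have hSm : MeasurableSet S := (isOpen_lt (by fun_prop) (by fun_prop)).measurableSet
  have hset : {U : OrthGroup n | 2 * t / 2 * ‖θ‖ ^ 2 < |⟪deviation k (rotate U H).1 θ, θ⟫_ℝ|} =
      (fun U : OrthGroup n => star (U : E n →L[ℝ] E n) e) ⁻¹' S := by
    ext U
    have h1 : ‖(rotate U H).1.starProjection (coordEmb n k θ)‖ =
        ‖θ‖ * ‖H.1.starProjection (star (U : E n →L[ℝ] E n) e)‖ := by
      rw [hθe, map_smul, norm_smul, norm_norm, starProjection_rotate]
      congr 1
      exact (Unitary.linearIsometryEquiv U).norm_map _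
    simp only [Set.mem_ofPred_eq, Set.mem_preimage, hS]
    rw [inner_deviation, h1, mul_pow, show 2 * (‖θ‖ ^ 2 * ‖H.1.starProjection
      (star (U : E n →L[ℝ] E n) e)‖ ^ 2) - ‖θ‖ ^ 2 = (2 * ‖H.1.starProjection
      (star (U : E n →L[ℝ] E n) e)‖ ^ 2 - 1) * ‖θ‖ ^ 2 by ring, abs_mul,
      abs_of_nonneg (sq_nonneg ‖θ‖), mul_lt_mul_iff_left₀ (by positivity)]
    rw [mul_div_cancel_left₀ _ two_ne_zero]
  have hmeas : Measurable fun U : OrthGroup n => star (U : E n →L[ℝ] E n) e :=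
    (Continuous.clm_apply (by fun_prop) continuous_const).measurable
  rw [hset, ← lintegral_indicator_one (hmeas hSm)]
  have h2 := lintegral_haarOrth_star_apply hen (F := S.indicator 1) (measurable_one.indicator hSm)
  have h3 : ∫⁻ θ, S.indicator 1 (θ : E n) ∂sphereMeasure (E n) = sphereMeasure (E n)
      {θ | t < |2 * ‖H.1.starProjection (θ : E n)‖ ^ 2 - 1|} := by
    have hSm' : MeasurableSet
        {θ : sphere (0 : E n) 1 | t < |2 * ‖H.1.starProjection (θ : E n)‖ ^ 2 - 1|} :=
      measurable_subtype_coe hSm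
    exact (lintegral_congr fun θ => rfl).trans (lintegral_indicator_one hSm')
  exact (h2.trans h3).trans_le (sphereMeasure_starProjection_le hm hn H.1 H.2 ht0 ht)

/-! ### The geometric mean of the two integrals -/

/-- A function of the first `k` coordinates on the sphere is a measurable function of the
projection to these coordinates: the projection has the continuous section
`y ↦ (y, √(1 - ‖y‖²), 0, …, 0)`. -/
theorem exists_measurable_factor_of_dependsOnFirst {n k : ℕ} (hk : k < n)
    {f : sphere (0 : E n) 1 → ℝ} (hf : Measurable f) (hdep : DependsOnFirst k f) :
    ∃ h : E k → ℝ≥0∞, Measurable h ∧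
      ∀ x : sphere (0 : E n) 1, ENNReal.ofReal (f x) = h (coordProj n k (x : E n)) := by
  set e : E n := EuclideanSpace.single ⟨k, hk⟩ 1 with he
  set v : E k → E n := fun y => coordEmb n k y + √(1 - ‖y‖ ^ 2) • e with hv
  have hcoord : ∀ (y : E k) (i : Fin n) (hi : (i : ℕ) < k), v y i = y ⟨i, hi⟩ := by
    intro y i hi
    have : i ≠ ⟨k, hk⟩ := by rintro rfl; exact lt_irrefl _ hi
    simp [hv, he, coordEmb_apply, hi, this]
  have hnorm : ∀ y : E k, ‖v y‖ ^ 2 = ‖y‖ ^ 2 + √(1 - ‖y‖ ^ 2) ^ 2 := by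
    intro y
    have h0 : ⟪coordEmb n k y, e⟫_ℝ = 0 := by
      rw [he, EuclideanSpace.inner_single_right, coordEmb_apply]; simp
    have h1 : ‖e‖ = 1 := by simp [he]
    simp only [hv]
    rw [@norm_add_sq_real, inner_smul_right, h0, norm_coordEmb hk.le, norm_smul, h1, mul_one,
      Real.norm_of_nonneg (Real.sqrt_nonneg _)]
    ring
  have hv0 : ∀ y, v y ≠ 0 := by
    intro y hy
    have h1 := hnorm y
    rw [hy, norm_zero] at h1
    have h2 : ‖y‖ ^ 2 = 0 := by nlinarith [sq_nonneg ‖y‖, sq_nonneg (√(1 - ‖y‖ ^ 2))]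
    rw [h2] at h1
    norm_num at h1
  set s : E k → sphere (0 : E n) 1 := fun y => ⟨‖v y‖⁻¹ • v y, by
    rw [mem_sphere_zero_iff_norm, norm_smul, norm_inv, norm_norm,
      inv_mul_cancel₀ (norm_ne_zero_iff.mpr (hv0 y))]⟩ with hs
  have hsm : Measurable s := by
    refine Measurable.subtype_mk ?_
    have : Measurable v := by fun_prop
    fun_prop
  refine ⟨fun y => ENNReal.ofReal (f (s y)), (hf.comp hsm).ennreal_ofReal, fun x => ?_⟩
  have hx : ‖(x : E n)‖ = 1 := mem_sphere_zero_iff_norm.mp x.2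
  congr 1
  refine hdep _ _ fun i hi => ?_
  set y := coordProj n k (x : E n) with hy
  have hy1 : ‖y‖ ^ 2 ≤ 1 := by
    have h1 : ‖y‖ ^ 2 = ⟪(x : E n), coordEmb n k y⟫_ℝ := by
      rw [← adjoint_coordProj, ContinuousLinearMap.adjoint_inner_right, real_inner_self_eq_norm_sq]
    have h2 := real_inner_le_norm (x : E n) (coordEmb n k y)
    rw [hx, norm_coordEmb hk.le, one_mul, ← h1] at h2
    nlinarith [norm_nonneg y]
  have hvn : ‖v y‖ = 1 := by
    have h1 := hnorm y
    rw [Real.sq_sqrt (by linarith)] at h1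
    nlinarith [norm_nonneg (v y)]
  change (x : E n) i = (‖v y‖⁻¹ • v y) i
  rw [hvn, inv_one, one_smul, hcoord y i hi, hy, coordProj_apply hk.le]
  rfl

/-- The bound on `f`, times Chernoff's bound for the mass of the points whose first `k` coordinates
have squared norm at least `δ`. Here `r = √n`, and the gain `δ d / 8`, about `r / 80000`, exceeds
the losses `10⁻⁶ r` and `k / 2` from the bound and from the first factor. -/
theorem exp_mul_chernoff_le {r k d δ : ℝ} (hr : 10 ^ 7 ≤ r) (hk0 : 0 ≤ k)
    (hk : k ≤ 1 / 10 ^ 6 * r) (hd : d = r ^ 2 - k) (hδ : δ = 1 / 10 ^ 4 / r) :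
    Real.exp (1 / 10 ^ 6 * r) * ((1 / (1 - 1 / 2 * (1 - δ))) ^ (k / 2) *
      (1 / (1 + 1 / 2 * δ)) ^ (d / 2)) ≤ 1 / 100 := by
  have hr0 : 0 < r := by linarith
  have hδ0 : 0 < δ := by rw [hδ]; positivity
  have hδ1 : δ ≤ 1 := by rw [hδ, div_le_one hr0]; norm_num; linarith
  have hd0 : 0 ≤ d := by rw [hd]; nlinarith
  have h1 : (1 / (1 - 1 / 2 * (1 - δ))) ^ (k / 2) ≤ Real.exp (k / 2) := by
    rw [Real.rpow_def_of_pos (by apply one_div_pos.mpr; linarith)]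
    refine Real.exp_le_exp.mpr ?_
    have h2 : Real.log (1 / (1 - 1 / 2 * (1 - δ))) ≤ 1 := by
      refine (Real.log_le_sub_one_of_pos (by apply one_div_pos.mpr; linarith)).trans ?_
      have : 1 / (1 - 1 / 2 * (1 - δ)) ≤ 2 := by
        rw [div_le_iff₀ (by linarith)]; linarith
      linarith
    nlinarith
  have h3 : (1 / (1 + 1 / 2 * δ)) ^ (d / 2) ≤ Real.exp (-(δ * d / 8)) := by
    rw [Real.rpow_def_of_pos (by positivity)]
    refine Real.exp_le_exp.mpr ?_
    have h2 : Real.log (1 / (1 + 1 / 2 * δ)) ≤ -(δ / 4) := by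
      refine (Real.log_le_sub_one_of_pos (by positivity)).trans ?_
      have : 1 / (1 + 1 / 2 * δ) ≤ 1 - δ / 4 := by
        rw [div_le_iff₀ (by positivity)]; nlinarith
      linarith
    nlinarith
  have h4 : δ * d = 1 / 10 ^ 4 * (r - k / r) := by
    rw [hδ, hd]; field_simp
  have h5 : k / r ≤ 1 := by rw [div_le_one hr0]; linarith
  calc _ ≤ Real.exp (1 / 10 ^ 6 * r) * (Real.exp (k / 2) * Real.exp (-(δ * d / 8))) := by gcongr
    _ = Real.exp (1 / 10 ^ 6 * r + k / 2 - δ * d / 8) := by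
        rw [← Real.exp_add, ← Real.exp_add]; congr 1; ring
    _ ≤ Real.exp (-100) := by
        refine Real.exp_le_exp.mpr ?_
        rw [h4]; linarith
    _ ≤ 1 / 100 := by
        rw [Real.exp_neg, ← one_div]
        have := Real.add_one_le_exp (100 : ℝ)
        exact one_div_le_one_div_of_le (by norm_num) (by linarith)

/-- The factor lost in `mul_sq_lintegral_le_mul_lintegral` for `r = √n`, `τ = 12 / √r`, `q = 3 / r`
and `s₀ = 10⁻⁴ / r`. The main term of the exponent is `(4 / 3) n τ² s₀ = 0.0192`. -/
theorem nine_tenths_le {r k : ℝ} (hr : 10 ^ 7 ≤ r) (hk0 : 0 ≤ k)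
    (hk : k ≤ 1 / 10 ^ 6 * r) :
    0.9 ≤ (1 - k * (3 / r)) * Real.exp (-(r ^ 2 * (4 / 3 * (12 / √r) ^ 2 * (1 / 10 ^ 4 / r) +
      16 * (1 / 10 ^ 4 / r) ^ 2) + (k + 2) * (1 / 10 ^ 4 / r))) := by
  have hr0 : 0 < r := by linarith
  have h1 : r ^ 2 * (4 / 3 * (12 / √r) ^ 2 * (1 / 10 ^ 4 / r) +
      16 * (1 / 10 ^ 4 / r) ^ 2) + (k + 2) * (1 / 10 ^ 4 / r) =
      192 / 10 ^ 4 + 16 / 10 ^ 8 + 1 / 10 ^ 4 * (k / r) + 2 / 10 ^ 4 * (1 / r) := by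
    rw [div_pow, Real.sq_sqrt hr0.le]; field_simp; ring
  have h2 : k / r ≤ 1 / 10 ^ 6 := by rwa [div_le_iff₀ hr0]
  have h2' : 0 ≤ k / r := by positivity
  have h3 : 1 / r ≤ 1 := by rw [div_le_one hr0]; linarith
  have h4 := Real.add_one_le_exp
    (-(192 / 10 ^ 4 + 16 / 10 ^ 8 + 1 / 10 ^ 4 * (k / r) + 2 / 10 ^ 4 * (1 / r)))
  have h5 : k * (3 / r) = 3 * (k / r) := by ring
  rw [h1, h5]
  calc (0.9 : ℝ) ≤ (1 - 3 * (1 / 10 ^ 6)) * 0.98 := by norm_num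
    _ ≤ _ := by
      refine mul_le_mul (by linarith) (le_trans ?_ h4) (by norm_num) (by linarith)
      norm_num at *
      linarith

/-- The deterministic part: the conclusion holds for each subspace `H` for which the compressed
projection is near `1/2`. -/
theorem le_sqrt_integral_mul_integral {n k : ℕ} (hr : 10 ^ 7 ≤ √(n : ℝ))
    (hk : (k : ℝ) ≤ 1 / 10 ^ 6 * √(n : ℝ)) {f : sphere (0 : E n) 1 → ℝ} (hf : Measurable f)
    (hf0 : ∀ x, 0 ≤ f x) (hdep : DependsOnFirst k f) (hf1 : eLpNorm f 1 (sphereMeasure (E n)) = 1)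
    (hf2 : eLpNorm f ∞ (sphereMeasure (E n)) ≤
      ENNReal.ofReal (Real.exp (1 / 10 ^ 6 * √(n : ℝ))))
    (H : Submodule ℝ (E n)) (hH : Module.finrank ℝ H = n / 2)
    (hdev : ‖deviation k H‖ ≤ 12 / √(√(n : ℝ))) :
    0.9 ≤ √((∫ x, f x ∂subspaceSphereMeasure H) * ∫ x, f x ∂subspaceSphereMeasure Hᗮ) := by
  set r := √(n : ℝ) with hrdef
  have hr0 : 0 < r := by linarith
  have hrn : (n : ℝ) = r ^ 2 := (Real.sq_sqrt n.cast_nonneg).symm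
  have hk0 : (0 : ℝ) ≤ k := k.cast_nonneg
  have hkm : 3 + k ≤ n / 2 := by
    have : 2 * (3 + k) ≤ n := by
      have h : (2 * (3 + k) : ℝ) ≤ n := by rw [hrn]; nlinarith
      exact_mod_cast h
    omega
  obtain ⟨d, hd⟩ : ∃ d, n = k + d := ⟨n - k, by omega⟩
  have hdR : (d : ℝ) = r ^ 2 - k := by rw [← hrn, hd]; push_cast; ring
  have hsr : 24 ≤ √r := Real.le_sqrt_of_sq_le (by norm_num; linarith)
  have hτ : 12 / √r ≤ 1 / 2 := by rw [div_le_iff₀ (by linarith)]; linarith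
  have hτ0 : 0 ≤ 12 / √r := by positivity
  have hD : ∀ z, ‖(2 : ℝ) • compression k H.starProjection z - z‖ ≤ 12 / √r * ‖z‖ := fun z =>
    (deviation k H).le_of_opNorm_le hdev z
  have hD' : ∀ z, ‖(2 : ℝ) • compression k Hᗮ.starProjection z - z‖ ≤ 12 / √r * ‖z‖ := by
    intro z
    convert! hD z using 1
    rw [compression_orthogonal (by omega), ← norm_neg]; congr 1; module
  have hH' : Module.finrank ℝ Hᗮ = n - n / 2 := by
    have := H.finrank_add_finrank_orthogonal
    rw [finrank_euclideanSpace_fin] at this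
    omega
  have : Nontrivial (E n) := Module.nontrivial_of_finrank_pos (R := ℝ) (by
    rw [finrank_euclideanSpace_fin]; omega)
  have : Nontrivial H := Module.nontrivial_of_finrank_pos (R := ℝ) (by omega)
  have : Nontrivial Hᗮ := Module.nontrivial_of_finrank_pos (R := ℝ) (by omega)
  have := isProbabilityMeasure_sphereMeasure (E n)
  have := isProbabilityMeasure_subspaceSphereMeasure H
  have := isProbabilityMeasure_subspaceSphereMeasure Hᗮ
  obtain ⟨h, hh, hfh⟩ := exists_measurable_factor_of_dependsOnFirst (by omega) hf hdep
  set K : ℝ≥0∞ := ENNReal.ofReal (Real.exp (1 / 10 ^ 6 * r)) with hK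
  have henorm : ∀ x, ‖f x‖ₑ = h (coordProj n k (x : E n)) := fun x => by
    rw [← hfh, Real.enorm_of_nonneg (hf0 x)]
  have hcm : ∀ {g : E k → ℝ≥0∞}, Measurable g →
      Measurable fun x : sphere (0 : E n) 1 => g (coordProj n k (x : E n)) := fun hg =>
    hg.comp ((coordProj n k).continuous.measurable.comp measurable_subtype_coe)
  have hL1 : ∫⁻ x, h (coordProj n k (x : E n)) ∂sphereMeasure (E n) = 1 := by
    rw [← hf1, eLpNorm_one_eq_lintegral_enorm]
    exact lintegral_congr fun x => (henorm x).symm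
  have hbound : ∀ᵐ x : sphere (0 : E n) 1 ∂sphereMeasure (E n),
      h (coordProj n k (x : E n)) ≤ K := by
    rw [eLpNorm_exponent_top] at hf2
    filter_upwards [enorm_ae_le_eLpNormEssSup f (sphereMeasure (E n))] with x hx
    rw [← henorm]
    exact hx.trans hf2
  -- The bound on `f` passes to the measures on `H` and `Hᗮ`, which makes `f` integrable there.
  set B : Set (E k) := {z | K < h z} with hB
  have hBm : MeasurableSet B := measurableSet_lt measurable_const hh
  have hzero : ∫⁻ x, B.indicator 1 (coordProj n k (x : E n)) ∂sphereMeasure (E n) = 0 := by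
    rw [lintegral_eq_zero_iff (hcm (measurable_one.indicator hBm))]
    filter_upwards [hbound] with x hx
    exact Set.indicator_of_notMem (show coordProj n k (x : E n) ∉ B from not_lt.mpr hx)
      (1 : E k → ℝ≥0∞)
  have hfin : ∀ (G : Submodule ℝ (E n)) [IsProbabilityMeasure (subspaceSphereMeasure G)],
      ∫⁻ x, B.indicator 1 (coordProj n k (x : E n)) ∂subspaceSphereMeasure G = 0 →
      ∫⁻ x, h (coordProj n k (x : E n)) ∂subspaceSphereMeasure G ≠ ∞ := by
    intro G _ hG
    rw [lintegral_eq_zero_iff (hcm (measurable_one.indicator hBm))] at hG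
    have hle : ∀ᵐ x : sphere (0 : E n) 1 ∂subspaceSphereMeasure G,
        h (coordProj n k (x : E n)) ≤ K := by
      filter_upwards [hG] with x hx
      by_contra! hlt
      have hx : B.indicator (1 : E k → ℝ≥0∞) (coordProj n k (x : E n)) = 0 := hx
      rw [Set.indicator_of_mem (show coordProj n k (x : E n) ∈ B from hlt)] at hx
      exact one_ne_zero hx
    refine ((lintegral_mono_ae hle).trans_lt ?_).ne
    rw [lintegral_const, measure_univ, mul_one]
    exact ENNReal.ofReal_lt_top
  have hfinA := hfin H (lintegral_subspace_eq_zero H (d := n / 2 - k) (by omega) (by omega)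
    (by omega) hd (by linarith) hD (measurable_one.indicator hBm) hzero)
  have hfinB := hfin Hᗮ (lintegral_subspace_eq_zero Hᗮ (d := n - n / 2 - k) (by omega) (by omega)
    (by omega) hd (by linarith) hD' (measurable_one.indicator hBm) hzero)
  have hint : ∀ G : Submodule ℝ (E n), ∫ x, f x ∂subspaceSphereMeasure G =
      (∫⁻ x, h (coordProj n k (x : E n)) ∂subspaceSphereMeasure G).toReal := by
    intro G
    rw [integral_eq_lintegral_of_nonneg_ae (Filter.Eventually.of_forall hf0)
      hf.aestronglyMeasurable]
    congr 1
    exact lintegral_congr hfh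
  -- The mass of `f` near the origin of `ℝᵏ` is at least `0.99`.
  set δ : ℝ := 1 / 10 ^ 4 / r with hδ
  set S : Set (E k) := {z | ‖z‖ ^ 2 ≤ δ} with hS
  have hSm : MeasurableSet S := measurableSet_le (by fun_prop) (by fun_prop)
  have hδ0 : 0 < δ := by positivity
  have hδ1 : δ ≤ 1 / 8 := by rw [hδ, div_le_iff₀ hr0]; norm_num; linarith
  have htail : ∫⁻ x, Sᶜ.indicator h (coordProj n k (x : E n)) ∂sphereMeasure (E n) ≤
      ENNReal.ofReal (1 / 100) := by
    have hch := sphereMeasure_le_norm_sq_le (V := E n) (j := k) (d := d)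
      (by rw [finrank_euclideanSpace_fin, hd]) (coordProj n k)
      (fun z => by rw [adjoint_coordProj, coordProj_coordEmb (by omega)]) (δ := δ) (μ := 1 / 2)
      (by norm_num) (by linarith) (by linarith)
    have hT : MeasurableSet {θ : sphere (0 : E n) 1 | δ ≤ ‖coordProj n k (θ : E n)‖ ^ 2} :=
      measurableSet_le (by fun_prop) (by fun_prop)
    calc ∫⁻ x, Sᶜ.indicator h (coordProj n k (x : E n)) ∂sphereMeasure (E n)
        ≤ ∫⁻ x, {θ : sphere (0 : E n) 1 | δ ≤ ‖coordProj n k (θ : E n)‖ ^ 2}.indicator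
            (fun _ => K) x ∂sphereMeasure (E n) := by
          refine lintegral_mono_ae ?_
          filter_upwards [hbound] with x hx
          by_cases hxS : coordProj n k (x : E n) ∈ S
          · rw [Set.indicator_of_notMem (by simpa using hxS)]; exact zero_le
          · rw [Set.indicator_of_mem (by simpa using hxS), Set.indicator_of_mem]
            · exact hx
            · have hxS : ¬ ‖coordProj n k (x : E n)‖ ^ 2 ≤ δ := hxS
              exact (not_le.mp hxS).le
      _ = K * sphereMeasure (E n) {θ | δ ≤ ‖coordProj n k (θ : E n)‖ ^ 2} := by
          rw [lintegral_indicator_const hT]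
      _ ≤ K * ENNReal.ofReal ((1 / (1 - 1 / 2 * (1 - δ))) ^ ((k : ℝ) / 2) *
            (1 / (1 + 1 / 2 * δ)) ^ ((d : ℝ) / 2)) := by gcongr
      _ ≤ _ := by
          rw [hK, ← ENNReal.ofReal_mul (Real.exp_pos _).le]
          exact ENNReal.ofReal_le_ofReal (exp_mul_chernoff_le hr hk0 hk hdR hδ)
  have hmain : ENNReal.ofReal 0.99 ≤
      ∫⁻ x, S.indicator h (coordProj n k (x : E n)) ∂sphereMeasure (E n) := by
    have hsum : ∫⁻ x, S.indicator h (coordProj n k (x : E n)) ∂sphereMeasure (E n) +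
        ∫⁻ x, Sᶜ.indicator h (coordProj n k (x : E n)) ∂sphereMeasure (E n) = 1 := by
      rw [← hL1, ← lintegral_add_left (hcm (hh.indicator hSm))]
      refine lintegral_congr fun x => ?_
      exact congrFun (Set.indicator_self_add_compl S h) _
    rw [← ENNReal.add_le_add_iff_right (a := ENNReal.ofReal (1 / 100)) ENNReal.ofReal_ne_top,
      ← ENNReal.ofReal_add (by norm_num) (by norm_num)]
    norm_num
    rw [← hsum]
    norm_num at htail
    gcongr
  have hq : 2 * (k : ℝ) + 5 ≤ 3 / r * n := by
    rw [hrn, show 3 / r * r ^ 2 = 3 * r by field_simp]; linarith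
  have hkey := mul_sq_lintegral_le_mul_lintegral H hkm rfl hH hd hτ0 hτ hD
    (q := 3 / r) (by rw [div_le_one hr0]; linarith) hq hδ1 (κ := 0.9) (by norm_num)
    (by rw [hrn]; exact nine_tenths_le hr hk0 hk) hh
  have hprod : ENNReal.ofReal (0.9 * 0.99 ^ 2) ≤
      (∫⁻ x, h (coordProj n k (x : E n)) ∂subspaceSphereMeasure H) *
        ∫⁻ x, h (coordProj n k (x : E n)) ∂subspaceSphereMeasure Hᗮ := by
    refine le_trans ?_ hkey
    rw [ENNReal.ofReal_mul (by norm_num), ENNReal.ofReal_pow (by norm_num)]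
    gcongr
  rw [hint, hint, ← ENNReal.toReal_mul]
  refine Real.le_sqrt_of_sq_le ?_
  have := (ENNReal.ofReal_le_iff_le_toReal (ENNReal.mul_ne_top hfinA hfinB)).mp hprod
  exact le_trans (by norm_num) this

theorem mainTheorem1 :
    ∃ α₁ α₂ α₃ : ℝ, 0 < α₁ ∧ 0 < α₂ ∧ 0 < α₃ ∧
      ∀ n k : ℕ, (k : ℝ) ≤ α₁ * √(n : ℝ) →
        ∀ f : sphere (0 : E n) 1 → ℝ, Measurable f → (∀ x, 0 ≤ f x) →
          DependsOnFirst k f →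
          eLpNorm f 1 (sphereMeasure (E n)) = 1 →
          eLpNorm f ∞ (sphereMeasure (E n)) ≤ ENNReal.ofReal (Real.exp (α₂ * √(n : ℝ))) →
          1 - α₃ * Real.exp (-√(n : ℝ)) ≤
            (haarGr n (n / 2) (Nat.div_le_self n 2)).real
              {H | 0.9 ≤ √((∫ x, f x ∂subspaceSphereMeasure H.1) *
                ∫ x, f x ∂subspaceSphereMeasure H.1ᗮ)} := by
  refine ⟨1 / 10 ^ 6, 1 / 10 ^ 6, Real.exp (10 ^ 7), by norm_num, by norm_num, Real.exp_pos _,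
    fun n k hk f hf hf0 hdep hf1 hf2 => ?_⟩
  -- For small `n` the constant `α₃` makes the bound trivial.
  rcases lt_or_ge (√(n : ℝ)) (10 ^ 7) with hr | hr
  · refine le_trans ?_ measureReal_nonneg
    rw [← Real.exp_add, sub_nonpos]
    exact Real.one_le_exp (by linarith)
  have := isProbabilityMeasure_haarOrth n
  have := isProbabilityMeasure_haarGr n (n / 2) (Nat.div_le_self n 2)
  set r := √(n : ℝ) with hrdef
  have hr0 : 0 < r := by linarith
  have hrn : (n : ℝ) = r ^ 2 := (Real.sq_sqrt n.cast_nonneg).symm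
  have hk0 : (0 : ℝ) ≤ k := k.cast_nonneg
  have hn1 : 1 ≤ n := by
    have h : (1 : ℝ) ≤ n := by rw [hrn]; nlinarith
    exact_mod_cast h
  have hkn : k ≤ n := by
    have h : (k : ℝ) ≤ n := by rw [hrn]; nlinarith
    exact_mod_cast h
  have hm : (n : ℝ) ≤ 2 * (n / 2 : ℕ) + 1 := by exact_mod_cast (by omega : n ≤ 2 * (n / 2) + 1)
  have hsr : 24 ≤ √r := Real.le_sqrt_of_sq_le (by norm_num; linarith)
  set H₀ := coordSubspace n (n / 2) (Nat.div_le_self n 2) with hH₀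
  set A := {H : Gr n (n / 2) | 0.9 ≤ √((∫ x, f x ∂subspaceSphereMeasure H.1) *
                ∫ x, f x ∂subspaceSphereMeasure H.1ᗮ)} with hA
  -- With this deviation Chernoff's exponent is `9 ⌊n / 2⌋ / √n`, which dominates `k log 9 + √n`.
  have hbad := haarOrth_deviation_le (k := k) rfl hn1 hkn H₀ (t := 6 / √r) (by positivity)
    (by rw [div_le_iff₀ (by linarith)]; linarith)
  set bad := {U : OrthGroup n | 2 * (6 / √r) < ‖deviation k (rotate U H₀).1‖} with hbaddef
  have hp : (9 : ℝ) ^ k * (4 * Real.exp (-((6 / √r) ^ 2 * (n / 2 : ℕ) / 4))) ≤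
      Real.exp (10 ^ 7) * Real.exp (-r) := by
    have h9 : (9 : ℝ) ^ k ≤ Real.exp (8 * k) := by
      rw [mul_comm, Real.exp_nat_mul]
      have := Real.add_one_le_exp (8 : ℝ)
      gcongr; linarith
    have h4 : (4 : ℝ) ≤ Real.exp 3 := by
      have := Real.add_one_le_exp (3 : ℝ); linarith
    have he : 2 * r ≤ (6 / √r) ^ 2 * (n / 2 : ℕ) / 4 := by
      rw [div_pow, Real.sq_sqrt hr0.le, le_div_iff₀ (by norm_num), div_mul_eq_mul_div,
        le_div_iff₀ hr0]
      nlinarith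
    calc _ ≤ Real.exp (8 * k) * (Real.exp 3 * Real.exp (-(2 * r))) := by gcongr
      _ = Real.exp (8 * k + 3 - 2 * r) := by
          rw [← Real.exp_add, ← Real.exp_add]; congr 1; ring
      _ ≤ Real.exp (10 ^ 7 + -r) := Real.exp_le_exp.mpr (by linarith)
      _ = _ := Real.exp_add _ _
  have hbad' : (haarOrth n).real bad ≤ Real.exp (10 ^ 7) * Real.exp (-r) := by
    refine le_trans ?_ hp
    refine ENNReal.toReal_le_of_le_ofReal (by positivity) (hbad.trans_eq ?_)
    rw [ENNReal.ofReal_mul (p := (9 : ℝ) ^ k) (by positivity), ENNReal.ofReal_pow (by norm_num)]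
    norm_num
  have hsub : badᶜ ⊆ (fun U => rotate U H₀) ⁻¹' A := by
    intro U hU
    refine le_sqrt_integral_mul_integral hr hk hf hf0 hdep hf1 hf2 _ (rotate U H₀).2 ?_
    have hU : ¬ 2 * (6 / √r) < ‖deviation k (rotate U H₀).1‖ := hU
    refine (not_lt.mp hU).trans_eq ?_
    ring
  have hgood : 1 ≤ (haarOrth n).real bad + (haarOrth n).real badᶜ := by
    have := measureReal_union_le (μ := haarOrth n) bad badᶜ
    rwa [Set.union_compl_self, probReal_univ] at this
  have hle : (haarOrth n).real badᶜ ≤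
      (haarGr n (n / 2) (Nat.div_le_self n 2)).real A := by
    refine ENNReal.toReal_mono (measure_ne_top _ _) ((measure_mono hsub).trans ?_)
    exact Measure.le_map_apply (continuous_rotate_left H₀).measurable.aemeasurable A
  refine le_trans ?_ hle
  linarith
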